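/- Let $D$ be a division algebra of degree $d$ over its center $C$ (so $[D:C]=d^2$), let $\sigma$ be an automorphism of $D$ of finite order $n$ modulo inner automorphisms, with $\sigma^n(z)=uzu^{-1}$ for all $z \in D$, where $u\in D^\times$ and $\sigma(u)=u$. Let $R=D[t;\sigma]$ be the skew polynomial ring (with $ta=\sigma(a)t$) and $F=C\cap\mathrm{Fix}(\sigma)$. Let $f\in R$ be monic and irreducible of degree $m>1$ with greatest common right divisor $(f,t)_r=1$, and let $h$ be its minimal central left multiple, i.e. the element of minimal degree in the center of $R$ which is a left multiple of $f$ and has the form $h(t)=\hat h(u^{-1}t^n)$ with $\hat h\in F[x]$ monic. Let $S_f$ be the Petit algebra of $f$, i.e. $\{g\in R : \deg g<m\}\cong R/Rf$ with the product $a\circ b = ab \bmod_r f$ (remainder of right division by $f$), let $B=\mathrm{Nuc}_r(S_f)=\{z\in S_f : (x\circ y)\circ z=x\circ(y\circ z)\text{ for all }x,y \in S_f\}$ be its right nucleus, and regard $V_f=R/Rf\cong S_f$ as a right $B$-module by right multiplication in $S_f$. Suppose that $\deg(h)=km$. Then $V_f$ has a right $B$-basis of $k$ elements. Fix any such basis,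 and for $a\in R$ let $M_a\in M_k(B)$ be the matrix, with respect to this basis, of the left multiplication $V_f\to V_f$, $b+Rf\mapsto ab+Rf$. Then $a+Rh\mapsto M_a$ is a well-defined ring isomorphism $R/Rh\to M_k(B)$. For every $a\in R$ a greatest common right divisor $\mathrm{gcrd}(a,h)$ exists, and the right $B$-linear map $L_{M_a}:M_k(B)\to M_k(B)$, $X\mapsto M_aX$, satisfies $$\dim_B(\mathrm{im}\,L_{M_a})=k^2-\frac{k}{m}\deg(\mathrm{gcrd}(a,h)),\qquad \mathrm{colrank}(M_a)=k-\frac1m\deg(\mathrm{gcrd}(a,h)),$$ where $\mathrm{colrank}(M_a)$ is the rank of the right $B$-module generated by the columns of $M_a$. In particular, if $\deg(h)=dmn$, then $k=dn$, the map $p(x)\mapsto p(u^{-1}t^n)+Rf$ induces an isomorphism of $E_{\hat h}=F[x]/(\hat h(x))$ onto $B$, so that $M_a$ becomes a matrix in $M_{dn}(E_{\hat h})$, and $$\mathrm{rank}(M_a)=dn-\frac1m\deg(\mathrm{gcrd}(a,h)).$$ -/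

import Mathlib

noncomputable section

namespace SkewRank

open SkewPolynomial

/-! ### Degrees, divisibility and right division in `D[t;σ]`

`SkewPolynomial D` is `D[t;σ]` (coefficients on the left, `t * a = σ a * t`), where
`σ a = Multiplicative.ofAdd 1 • a`. -/

section Degree

variable {D : Type*} [DivisionRing D]

/-- The degree of a skew polynomial, with `deg 0 = ⊥`. -/
def deg (p : SkewPolynomial D) : WithBot ℕ := p.support.max

/-- The degree of a skew polynomial as a natural number (`0` for the zero polynomial). -/
def natDeg (p : SkewPolynomial D) : ℕ := (deg p).unbotD 0

/-- A skew polynomial is monic if its leading coefficient is `1`. -/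
def IsMonic (p : SkewPolynomial D) : Prop := p.coeff (natDeg p) = 1

lemma deg_lt_iff (p : SkewPolynomial D) (m : ℕ) :
    deg p < m ↔ ∀ i, m ≤ i → p.coeff i = 0 := by
  unfold deg
  have hb : (⊥ : WithBot ℕ) < (m : WithBot ℕ) := WithBot.bot_lt_coe m
  rw [Finset.max_eq_sup_withBot]
  have key : p.support.sup WithBot.some < (m : WithBot ℕ) ↔
      ∀ i ∈ p.support, (WithBot.some i : WithBot ℕ) < (m : WithBot ℕ) := Finset.sup_lt_iff hb
  refine key.trans ?_
  constructor
  · intro h i hi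
    by_contra hc
    have h2 : i < m := WithBot.coe_lt_coe.mp (h i (mem_support_iff.mpr hc))
    omega
  · intro h i hi
    refine WithBot.coe_lt_coe.mpr ?_
    by_contra hc
    exact (mem_support_iff.mp hi) (h i (Nat.le_of_not_lt hc))

lemma IsMonic.ne_zero {f : SkewPolynomial D} (hf : IsMonic f) : f ≠ 0 := by
  rintro rfl
  simp [IsMonic] at hf

lemma deg_eq_natDeg {p : SkewPolynomial D} (hp : p ≠ 0) : deg p = (natDeg p : WithBot ℕ) := by
  have hne : p.support.Nonempty := by
    rw [Finset.nonempty_iff_ne_empty]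
    simpa using hp
  obtain ⟨b, hb⟩ := Finset.max_of_nonempty hne
  have hb' : deg p = (b : WithBot ℕ) := hb
  simp [natDeg, hb']

lemma coeff_natDeg_ne_zero {p : SkewPolynomial D} (hp : p ≠ 0) : p.coeff (natDeg p) ≠ 0 :=
  mem_support_iff.mp (Finset.mem_of_max (deg_eq_natDeg hp))

lemma coeff_eq_zero_of_natDeg_lt {p : SkewPolynomial D} {i : ℕ} (h : natDeg p < i) :
    p.coeff i = 0 := by
  by_cases hp : p = 0
  · simp [hp]
  · refine (deg_lt_iff p i).mp ?_ i le_rfl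
    rw [deg_eq_natDeg hp]
    exact_mod_cast h

variable [MulSemiringAction (Multiplicative ℕ) D]

lemma coeff_monomial_mul (i j : ℕ) (a : D) (f : SkewPolynomial D) :
    (monomial i a * f).coeff j = if i ≤ j then a * φ^[i] (f.coeff (j - i)) else 0 := by
  induction f using SkewPolynomial.induction with
  | h0 => simp
  | ha n r q _ _ hq =>
    rw [mul_add, coeff_add, hq, monomial_mul_monomial, coeff_monomial, coeff_add, coeff_monomial]
    by_cases hij : i ≤ j
    · by_cases h2 : i + n = j
      · have h3 : n = j - i := by omega
        simp [hij, h3, iterate_map_add, mul_add]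
      · have h3 : ¬ n = j - i := by omega
        simp [hij, h2, h3]
    · have h2 : ¬ i + n = j := by omega
      simp [hij, h2]

lemma coeff_mul_top (q f : SkewPolynomial D) (hf : IsMonic f) :
    (q * f).coeff (natDeg q + natDeg f) = q.coeff (natDeg q) := by
  have hq : q * f = ∑ i ∈ q.support, monomial i (q.coeff i) * f := by
    rw [← Finset.sum_mul, ← sum_def, sum_monomial]
  rw [hq]
  have hsum : ∀ s : Finset ℕ, ∀ g : ℕ → SkewPolynomial D, ∀ j,
      (∑ i ∈ s, g i).coeff j = ∑ i ∈ s, (g i).coeff j := by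
    intro s g j
    induction s using Finset.induction_on with
    | empty => simp
    | insert a s ha ih => rw [Finset.sum_insert ha, Finset.sum_insert ha, coeff_add, ih]
  rw [hsum, Finset.sum_eq_single (natDeg q)]
  · rw [coeff_monomial_mul]
    have hf' : f.coeff (natDeg f) = 1 := hf
    simp [hf', iterate_map_one]
  · intro i hi hne
    rw [coeff_monomial_mul]
    have h1 : i < natDeg q := by
      by_contra hc
      exact (mem_support_iff.mp hi) (coeff_eq_zero_of_natDeg_lt (by omega))
    rw [coeff_eq_zero_of_natDeg_lt (p := f) (by omega)]
    simp
  · intro hi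
    rw [notMem_support_iff.mp hi]
    simp

/-- A left multiple of a monic `f` of degree less than `deg f` vanishes. -/
lemma eq_zero_of_deg_lt {f : SkewPolynomial D} (hf : IsMonic f) {r : SkewPolynomial D}
    (hr : r ∈ Ideal.span {f}) (hd : deg r < deg f) : r = 0 := by
  obtain ⟨q, rfl⟩ := Ideal.mem_span_singleton'.mp hr
  by_cases hq : q = 0
  · simp [hq]
  · rw [deg_eq_natDeg hf.ne_zero, deg_lt_iff] at hd
    exact absurd ((coeff_mul_top q f hf).symm.trans (hd _ (by omega))) (coeff_natDeg_ne_zero hq)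

/-- Right division with remainder by a monic skew polynomial. -/
lemma exists_rem {f : SkewPolynomial D} (hf : IsMonic f) (g : SkewPolynomial D) :
    ∃ r, deg r < deg f ∧ g - r ∈ Ideal.span {f} := by
  rw [deg_eq_natDeg hf.ne_zero]
  have key : ∀ N : ℕ, ∀ g : SkewPolynomial D, (∀ i, N ≤ i → g.coeff i = 0) →
      ∃ r, deg r < (natDeg f : WithBot ℕ) ∧ g - r ∈ Ideal.span {f} := by
    intro N
    induction N with
    | zero =>
      intro g hg
      refine ⟨g, (deg_lt_iff _ _).mpr fun i _ => hg i (Nat.zero_le i), by simp⟩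
    | succ N ih =>
      intro g hg
      by_cases hN : N < natDeg f
      · exact ⟨g, (deg_lt_iff _ _).mpr fun i hi => hg i (by omega), by simp⟩
      · have hf' : f.coeff (natDeg f) = 1 := hf
        have hc : ∀ i, N ≤ i →
            (g + monomial (N - natDeg f) (-(g.coeff N)) * f).coeff i = 0 := by
          intro i hi
          rw [coeff_add, coeff_monomial_mul, if_pos (by omega)]
          rcases Nat.eq_or_lt_of_le hi with h | h
          · subst h
            rw [show N - (N - natDeg f) = natDeg f by omega, hf', iterate_map_one]
            simp
          · rw [hg i (by omega), coeff_eq_zero_of_natDeg_lt (p := f) (by omega)]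
            simp
        obtain ⟨r, hr, hmem⟩ := ih _ hc
        refine ⟨r, hr, ?_⟩
        have h2 : monomial (N - natDeg f) (-(g.coeff N)) * f ∈ Ideal.span {f} :=
          Ideal.mem_span_singleton'.mpr ⟨_, rfl⟩
        have h3 := sub_mem hmem h2
        have h4 : g + monomial (N - natDeg f) (-(g.coeff N)) * f - r
            - monomial (N - natDeg f) (-(g.coeff N)) * f = g - r := by abel
        rwa [h4] at h3
  exact key (natDeg g + 1) g fun i hi => coeff_eq_zero_of_natDeg_lt (by omega)

end Degree

section Gcrd

variable {D : Type*} [DivisionRing D] [MulSemiringAction (Multiplicative ℕ) D]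

/-- `g` is a right divisor of `a`. -/
def RightDvd (g a : SkewPolynomial D) : Prop := ∃ q, a = q * g

/-- `g` is a greatest common right divisor of `a` and `b`. -/
def IsGCRD (g a b : SkewPolynomial D) : Prop :=
  RightDvd g a ∧ RightDvd g b ∧ ∀ e, RightDvd e a → RightDvd e b → RightDvd e g

end Gcrd

/-! ### The right nucleus of a nonassociative ring -/

section Nucleus

variable (S : Type*) [NonAssocRing S]

/-- The right nucleus `Nuc_r(S) = {z | (x y) z = x (y z) for all x, y}`. -/
def rightNucleus : NonUnitalSubring S where
  carrier := {z | ∀ x y : S, (x * y) * z = x * (y * z)}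
  add_mem' := by
    intro a b ha hb x y
    rw [mul_add, ha x y, hb x y, mul_add, mul_add]
  zero_mem' := by intro x y; simp
  neg_mem' := by
    intro a ha x y
    rw [mul_neg, ha x y, mul_neg, mul_neg]
  mul_mem' := by
    intro a b ha hb x y
    rw [← hb (x * y) a, ha x y, hb x (y * a), hb y a]

instance : One (rightNucleus S) := ⟨⟨1, fun x y => by simp⟩⟩

instance rightNucleus.instRing : Ring (rightNucleus S) :=
  { (inferInstance : NonUnitalNonAssocRing (rightNucleus S)) with
    one := 1
    one_mul := fun a => Subtype.ext (one_mul (a : S))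
    mul_one := fun a => Subtype.ext (mul_one (a : S))
    mul_assoc := fun a b c => Subtype.ext (c.2 (a : S) (b : S)) }

/-- Every nonassociative ring is a right module over its right nucleus, by right
multiplication. -/
instance rightNucleus.instModule : Module (rightNucleus S)ᵐᵒᵖ S where
  smul z x := x * (z.unop : S)
  one_smul x := mul_one x
  mul_smul z w x := (z.unop.2 x (w.unop : S)).symm
  smul_zero _ := zero_mul _
  smul_add _ _ _ := add_mul _ _ _
  add_smul _ _ _ := mul_add _ _ _
  zero_smul x := mul_zero x

end Nucleus

/-! ### The Petit algebra `S_f` on `V_f = R/Rf` -/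

section Petit

variable {D : Type*} [DivisionRing D] [MulSemiringAction (Multiplicative ℕ) D]

/-- The left `R`-module `V_f = R/Rf`; it is also the underlying module of the Petit algebra `S_f`,
since every class has exactly one representative of degree less than `deg f`. -/
def PetitAlgebra (f : SkewPolynomial D) (_hf : IsMonic f) : Type _ :=
  SkewPolynomial D ⧸ Ideal.span {f}

namespace PetitAlgebra

variable (f : SkewPolynomial D) (hf : IsMonic f)

instance : AddCommGroup (PetitAlgebra f hf) :=
  inferInstanceAs (AddCommGroup (SkewPolynomial D ⧸ Ideal.span {f}))

/-- Left multiplication of `R` on `R/Rf`: `a • (b + Rf) = ab + Rf`. -/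
instance : Module (SkewPolynomial D) (PetitAlgebra f hf) :=
  inferInstanceAs (Module (SkewPolynomial D) (SkewPolynomial D ⧸ Ideal.span {f}))

/-- The class `a + Rf`. -/
def mk : SkewPolynomial D →ₗ[SkewPolynomial D] PetitAlgebra f hf :=
  Submodule.mkQ (Ideal.span {f})

lemma mk_surjective : Function.Surjective (mk f hf) := Submodule.mkQ_surjective _

lemma mk_eq_zero {a : SkewPolynomial D} : mk f hf a = 0 ↔ a ∈ Ideal.span {f} :=
  Submodule.Quotient.mk_eq_zero _

lemma exists_rep (x : PetitAlgebra f hf) : ∃ r, deg r < deg f ∧ mk f hf r = x := by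
  obtain ⟨g, rfl⟩ := mk_surjective f hf x
  obtain ⟨r, hr, hm⟩ := exists_rem hf g
  refine ⟨r, hr, ?_⟩
  have := (mk_eq_zero f hf).mpr hm
  rw [map_sub, sub_eq_zero] at this
  exact this.symm

/-- The representative of degree less than `deg f` of a class in `R/Rf`, i.e. the remainder of
right division by `f` of any of its elements. -/
def rep (x : PetitAlgebra f hf) : SkewPolynomial D := (exists_rep f hf x).choose

lemma deg_rep (x : PetitAlgebra f hf) : deg (rep f hf x) < deg f :=
  (exists_rep f hf x).choose_spec.1

lemma mk_rep (x : PetitAlgebra f hf) : mk f hf (rep f hf x) = x :=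
  (exists_rep f hf x).choose_spec.2

lemma rep_unique {x : PetitAlgebra f hf} {r : SkewPolynomial D} (hr : deg r < deg f)
    (hx : mk f hf r = x) : rep f hf x = r := by
  have h1 : rep f hf x - r ∈ Ideal.span {f} := by
    rw [← mk_eq_zero f hf, map_sub, mk_rep, hx, sub_self]
  refine sub_eq_zero.mp (eq_zero_of_deg_lt hf h1 ?_)
  have h2 := deg_rep f hf x
  rw [deg_eq_natDeg hf.ne_zero, deg_lt_iff] at *
  intro i hi
  rw [sub_eq_add_neg, coeff_add, h2 i hi]
  have : (-r).coeff i = 0 := by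
    have h3 := coeff_add r (-r) i
    rw [add_neg_cancel, coeff_zero, hr i hi, zero_add] at h3
    exact h3.symm
  rw [this, add_zero]

lemma rep_add (x y : PetitAlgebra f hf) :
    rep f hf (x + y) = rep f hf x + rep f hf y := by
  refine rep_unique f hf ?_ (by rw [map_add, mk_rep, mk_rep])
  have h1 := deg_rep f hf x
  have h2 := deg_rep f hf y
  rw [deg_eq_natDeg hf.ne_zero, deg_lt_iff] at *
  intro i hi
  rw [coeff_add, h1 i hi, h2 i hi, add_zero]

lemma rep_zero : rep f hf 0 = 0 :=
  rep_unique f hf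
    (by rw [deg_eq_natDeg hf.ne_zero, deg_lt_iff]; intro i _; simp) (map_zero _)

/-- The product of `S_f`: multiply the representatives of degree less than `deg f` in `R` and
reduce modulo `Rf`. -/
instance : Mul (PetitAlgebra f hf) := ⟨fun x y => mk f hf (rep f hf x * rep f hf y)⟩

lemma mul_def (x y : PetitAlgebra f hf) : x * y = mk f hf (rep f hf x * rep f hf y) := rfl

lemma mul_eq_smul (x y : PetitAlgebra f hf) : x * y = rep f hf x • y := by
  rw [mul_def, ← smul_eq_mul, map_smul, mk_rep]

instance : One (PetitAlgebra f hf) := ⟨mk f hf 1⟩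

lemma one_def : (1 : PetitAlgebra f hf) = mk f hf 1 := rfl

lemma one_mul' (x : PetitAlgebra f hf) : 1 * x = x := by
  rw [mul_eq_smul]
  by_cases hm : natDeg f = 0
  · have h0 : x = 0 := by
      have h := deg_rep f hf x
      rw [deg_eq_natDeg hf.ne_zero, hm, deg_lt_iff] at h
      have h1 : rep f hf x = 0 := by
        ext i
        simpa using h i (Nat.zero_le i)
      rw [← mk_rep f hf x, h1, map_zero]
    rw [h0, smul_zero]
  · have h1 : rep f hf 1 = 1 := by
      refine rep_unique f hf ?_ rfl
      rw [deg_eq_natDeg hf.ne_zero, deg_lt_iff]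
      intro i hi
      rw [coeff_one, if_neg (by omega)]
    rw [h1, one_smul]

instance : NonAssocRing (PetitAlgebra f hf) :=
  { (inferInstance : AddCommGroup (PetitAlgebra f hf)) with
    mul := (· * ·)
    one := 1
    left_distrib := fun x y z => by
      change x * (y + z) = x * y + x * z
      rw [mul_eq_smul, mul_eq_smul, mul_eq_smul, smul_add]
    right_distrib := fun x y z => by
      change (x + y) * z = x * z + y * z
      rw [mul_eq_smul, mul_eq_smul, mul_eq_smul, rep_add, add_smul]
    zero_mul := fun x => by
      change 0 * x = 0
      rw [mul_eq_smul, rep_zero, zero_smul]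
    mul_zero := fun x => by
      change x * 0 = 0
      rw [mul_eq_smul, smul_zero]
    one_mul := one_mul' f hf
    mul_one := fun x => by
      change x * 1 = x
      rw [mul_eq_smul, one_def, ← map_smul, smul_eq_mul, mul_one, mk_rep] }

end PetitAlgebra

/-- The right nucleus `B = Nuc_r(S_f)` of the Petit algebra. -/
abbrev NucR (f : SkewPolynomial D) (hf : IsMonic f) : Type _ := rightNucleus (PetitAlgebra f hf)

/-- The matrix `M_a ∈ M_k(B)` of the left multiplication `L_a : V_f → V_f`,
`b + Rf ↦ ab + Rf`, with respect to a right `B`-basis `e` of `V_f`: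
`L_a(e_j) = ∑ i, e_i (M_a)_{ij}`. -/
def leftMulMatrix {f : SkewPolynomial D} {hf : IsMonic f} {k : ℕ}
    (e : Module.Basis (Fin k) (NucR f hf)ᵐᵒᵖ (PetitAlgebra f hf)) (a : SkewPolynomial D) :
    Matrix (Fin k) (Fin k) (NucR f hf) :=
  Matrix.of fun i j => (e.repr (a • e j) i).unop

end Petit

/-! ### Ranks over a noncommutative ring -/

section Rank

variable {B : Type*} [Ring B] {k : ℕ}

/-- The column rank: the rank of the right `B`-module generated by the columns. -/
def colRank (A : Matrix (Fin k) (Fin k) B) : ℕ :=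
  Module.finrank Bᵐᵒᵖ (Submodule.span Bᵐᵒᵖ (Set.range A.col))

/-- The right `B`-linear map `L_A : M_k(B) → M_k(B)`, `X ↦ A X`. -/
def mulLeftMap (A : Matrix (Fin k) (Fin k) B) :
    Matrix (Fin k) (Fin k) B →ₗ[Bᵐᵒᵖ] Matrix (Fin k) (Fin k) B where
  toFun X := A * X
  map_add' X Y := Matrix.mul_add A X Y
  map_smul' c X := Matrix.mul_smul A c X

end Rank

/-! ### The minimal central left multiple -/

section Mclm

variable {D : Type*} [DivisionRing D]

/-- The field `F = C ∩ Fix(σ)`, where `C` is the center of `D`. -/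
def fixedCenter (σ : D ≃+* D) : Subfield (Subring.center D) where
  carrier := {c | σ (c : D) = c}
  mul_mem' := by intro a b ha hb; simp_all
  one_mem' := by simp
  add_mem' := by intro a b ha hb; simp_all
  zero_mem' := by simp
  neg_mem' := by intro a ha; simp_all
  inv_mem' := by
    intro a ha
    have h : (((a⁻¹ : Subring.center D)) : D) = (a : D)⁻¹ := by
      by_cases h0 : a = 0
      · simp [h0]
      · have h0' : (a : D) ≠ 0 := fun h => h0 (Subtype.ext h)
        refine eq_inv_of_mul_eq_one_left ?_
        have := congrArg (Subtype.val) (inv_mul_cancel₀ h0)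
        simpa using this
    simp only [Set.mem_ofPred_eq] at ha ⊢
    rw [h, map_inv₀, ha]

variable [MulSemiringAction (Multiplicative ℕ) D]

/-- The element `p(u⁻¹ tⁿ)` of `R = D[t;σ]` for a polynomial `p(x) ∈ F[x]`. -/
def evalCentral (σ : D ≃+* D) (n : ℕ) (u : D) (p : Polynomial (fixedCenter σ)) :
    SkewPolynomial D :=
  p.eval₂ ((CRingHom.comp (Subring.center D).subtype).comp (fixedCenter σ).subtype)
    (C u⁻¹ * X ^ n)

/-- `h = ĥ(u⁻¹ tⁿ)` with `ĥ ∈ F[x]` monic is the minimal central left multiple of `f`: it is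
central, a left multiple of `f`, and of minimal degree among all such elements. -/
structure IsMclm (σ : D ≃+* D) (n : ℕ) (u : D) (f : SkewPolynomial D)
    (h : Subring.center (SkewPolynomial D)) (hhat : Polynomial (fixedCenter σ)) : Prop where
  monic : hhat.Monic
  eq_eval : (h : SkewPolynomial D) = evalCentral σ n u hhat
  rightDvd : RightDvd f (h : SkewPolynomial D)
  minimal : ∀ (h' : Subring.center (SkewPolynomial D)) (hhat' : Polynomial (fixedCenter σ)),
    hhat'.Monic → (h' : SkewPolynomial D) = evalCentral σ n u hhat' →
    RightDvd f (h' : SkewPolynomial D) → deg (h : SkewPolynomial D) ≤ deg (h' : SkewPolynomial D)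

end Mclm

/-- The left ideal generated by a central element is two-sided, so `R/Rh` is a ring. -/
instance isTwoSided_span_center {R : Type*} [Ring R] (h : Subring.center R) :
    (Ideal.span {(h : R)}).IsTwoSided where
  mul_mem_of_left := by
    intro a b ha
    obtain ⟨c, rfl⟩ := Ideal.mem_span_singleton'.mp ha
    refine Ideal.mem_span_singleton'.mpr ⟨c * b, ?_⟩
    rw [mul_assoc, mul_assoc, Subring.mem_center_iff.mp h.2 b]

end SkewRank

end

/-!
The left module `V_f = R/Rf` is simple, and when `deg f > 1` its endomorphisms are the right
multiplications by `B = Nuc_r(S_f)`, so `B` is a division ring. The annihilator of `V_f` is a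
nonzero two-sided ideal, hence generated by a central element `p(u⁻¹tⁿ)`, and the minimality of `h`
forces it to be `Rh`. By the density theorem `R/Rh` then represents all `B`-linear endomorphisms of
`V_f`, and comparing dimensions over `D` gives `deg h = dim_B(V_f) * deg f`.

The rank of `M_a` follows from a double annihilator argument: the elements of `R` that vanish on
`ker(v ↦ av)` form the left ideal `Ra + Rh = R gcrd(a, h)`, and by density the left ideal vanishing
on a `B`-subspace `W` of `V_f` has codimension `dim_B(W) * deg f` over `D`. When `deg h` is maximal,
counting dimensions over `F`, with `[D : F] ≤ n [D : C]`, shows that the embedding `E_ĥ → B` is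
onto.
-/

noncomputable section

namespace SkewRank

open SkewPolynomial

section SimpleModule

lemma exists_comp_eq_of_ker_le {K U V W : Type*} [DivisionRing K] [AddCommGroup U] [Module K U]
    [AddCommGroup V] [Module K V] [AddCommGroup W] [Module K W] {φ : U →ₗ[K] V} {ψ : U →ₗ[K] W}
    (h : LinearMap.ker φ ≤ LinearMap.ker ψ) : ∃ χ : V →ₗ[K] W, χ ∘ₗ φ = ψ := by
  obtain ⟨χ, hχ⟩ := LinearMap.exists_extend
    ((LinearMap.ker φ).liftQ ψ h ∘ₗ φ.quotKerEquivRange.symm.toLinearMap)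
  refine ⟨χ, LinearMap.ext fun v => ?_⟩
  simpa using DFunLike.congr_fun hχ (φ.quotKerEquivRange ((LinearMap.ker φ).mkQ v))

variable {A K V : Type*} [Ring A] [AddCommGroup V] [Module A V]

lemma isUnit_or_eq_zero_of_forall_end_eq_smul [IsSimpleModule A V] [Ring K] [Module K V]
    [SMulCommClass A K V] [FaithfulSMul K V]
    (hK : ∀ φ : Module.End A V, ∃ c : K, ∀ v, φ v = c • v) (c : K) : IsUnit c ∨ c = 0 := by
  have := SMulCommClass.symm A K V
  have hinj : Function.Injective (Module.toModuleEnd A (S := K) V) := fun c c' h =>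
    FaithfulSMul.eq_of_smul_eq_smul fun v : V => DFunLike.congr_fun h v
  have hsurj : Function.Surjective (Module.toModuleEnd A (S := K) V) := fun φ =>
    (hK φ).imp fun c hc => LinearMap.ext fun v => (hc v).symm
  let e : K ≃+* Module.End A V := RingEquiv.ofBijective _ ⟨hinj, hsurj⟩
  rcases LinearMap.bijective_or_eq_zero (e c) with h | h
  · exact .inl ((MulEquiv.isUnit_map e).mp ((Module.End.isUnit_iff _).mpr h))
  · exact .inr ((map_eq_zero_iff e e.injective).mp h)

variable [DivisionRing K] [Module K V]

lemma exists_smul_eq_of_linearIndependent [IsSimpleModule A V]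
    (hK : ∀ φ : Module.End A V, ∃ c : K, ∀ v, φ v = c • v) {ι : Type*} [Finite ι] {w : ι → V}
    (hw : LinearIndependent K w) (t : ι → V) : ∃ a : A, ∀ i, a • w i = t i := by
  classical
  cases nonempty_fintype ι
  obtain ⟨φ, hφ⟩ := LinearMap.exists_extend ((Module.Basis.span hw).constr ℕ t)
  have hφw (i : ι) : φ (w i) = t i := by
    rw [← Module.Basis.constr_basis (Module.Basis.span hw) ℕ t i, ← hφ, LinearMap.comp_apply,
      Submodule.subtype_apply, Module.Basis.span_apply]
  let ψ : Module.End (Module.End A V) V :=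
    { φ with
      map_smul' := fun α v => by
        obtain ⟨c, hc⟩ := hK α
        change φ (α v) = α (φ v)
        rw [hc, hc, map_smul] }
  obtain ⟨a, ha⟩ := jacobson_density ψ (Finset.univ.image w)
  exact ⟨a, fun i => (ha _ (Finset.mem_image_of_mem w (Finset.mem_univ i))).symm.trans (hφw i)⟩

lemma finite_of_finite_quotient_annihilator [IsSimpleModule A V] {D : Type*} [DivisionRing D]
    [Module D A] [IsScalarTower D A A] [Module D V] [IsScalarTower D A V] [Module.Finite D V]
    [Module.Finite D (A ⧸ Module.annihilator A V)]
    (hK : ∀ φ : Module.End A V, ∃ c : K, ∀ v, φ v = c • v) : Module.Finite K V := by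
  have hrank : Module.rank K V ≤ (Module.finrank D (A ⧸ Module.annihilator A V) : ℕ) := by
    refine rank_le fun s hs => ?_
    let T : (A ⧸ Module.annihilator A V) →ₗ[A] (s → V) :=
      (Module.annihilator A V).liftQ (LinearMap.toSpanSingleton A (s → V) Subtype.val)
        fun a ha => funext fun i => Module.mem_annihilator.mp ha i
    have hT : Function.Surjective (T.restrictScalars D) := fun t =>
      (exists_smul_eq_of_linearIndependent hK hs t).elim fun a ha =>
        ⟨Submodule.Quotient.mk a, funext ha⟩
    have hle := LinearMap.finrank_le_finrank_of_surjective hT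
    have := IsSimpleModule.nontrivial A V
    have hpos : 0 < Module.finrank D V := Module.finrank_pos
    rw [Module.finrank_pi_fintype, Finset.sum_const, smul_eq_mul, Finset.card_univ,
      Fintype.card_coe] at hle
    exact (Nat.le_mul_of_pos_right _ hpos).trans hle
  exact Module.rank_lt_aleph0_iff.mp (hrank.trans_lt Cardinal.natCast_lt_aleph0)

/-- The left ideal of the elements of `A` that annihilate every vector of the `K`-subspace `W`. -/
def annihilatorOn (A : Type*) [Ring A] [Module A V] (W : Submodule K V) : Ideal A where
  carrier := {a | ∀ w ∈ W, a • w = 0}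
  add_mem' ha hb w hw := by rw [add_smul, ha w hw, hb w hw, add_zero]
  zero_mem' w _ := zero_smul A w
  smul_mem' x a ha w hw := by rw [smul_eq_mul, mul_smul, ha w hw, smul_zero]

lemma mem_annihilatorOn {W : Submodule K V} {a : A} :
    a ∈ annihilatorOn A W ↔ ∀ w ∈ W, a • w = 0 :=
  Iff.rfl

lemma annihilatorOn_top : annihilatorOn A (⊤ : Submodule K V) = Module.annihilator A V := by
  ext a
  simp [mem_annihilatorOn, Module.mem_annihilator]

variable [SMulCommClass A K V]

lemma ker_toSpanSingleton_eq_annihilatorOn {ι : Type*} (w : ι → V) :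
    LinearMap.ker (LinearMap.toSpanSingleton A (ι → V) w) =
      annihilatorOn A (Submodule.span K (Set.range w)) := by
  ext a
  have hspan : Submodule.span K (Set.range w) ≤ LinearMap.ker (DistribSMul.toLinearMap K V a) ↔
      ∀ i, a • w i = 0 := by
    rw [Submodule.span_le, Set.range_subset_iff]
    rfl
  exact funext_iff.trans hspan.symm

lemma ker_toModuleEnd_eq_annihilator :
    RingHom.ker (Module.toModuleEnd K (S := A) V) = Module.annihilator A V := by
  ext a
  exact LinearMap.ext_iff.trans Module.mem_annihilator.symm

variable [IsSimpleModule A V]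

lemma exists_forall_smul_eq [Module.Finite K V]
    (hK : ∀ φ : Module.End A V, ∃ c : K, ∀ v, φ v = c • v) (φ : V →ₗ[K] V) :
    ∃ a : A, ∀ v, a • v = φ v := by
  let b := Module.finBasis K V
  obtain ⟨a, ha⟩ := exists_smul_eq_of_linearIndependent hK b.linearIndependent (φ ∘ b)
  have hφ : DistribSMul.toLinearMap K V a = φ := b.ext ha
  exact ⟨a, DFunLike.congr_fun hφ⟩

/-- Over its endomorphism division ring `K`, a simple module `V` that is finite-dimensional
represents `A` onto all `K`-linear maps. -/
def quotientAnnihilatorEquivEnd [Module.Finite K V]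
    (hK : ∀ φ : Module.End A V, ∃ c : K, ∀ v, φ v = c • v) :
    A ⧸ Module.annihilator A V ≃+* Module.End K V :=
  (Ideal.quotEquivOfEq ker_toModuleEnd_eq_annihilator.symm).trans <|
    RingHom.quotientKerEquivOfSurjective fun φ =>
      (exists_forall_smul_eq hK φ).imp fun _ => LinearMap.ext

lemma annihilatorOn_ker_smul [Module.Finite K V]
    (hK : ∀ φ : Module.End A V, ∃ c : K, ∀ v, φ v = c • v) (a : A) :
    annihilatorOn A (LinearMap.ker (DistribSMul.toLinearMap K V a)) =
      Ideal.span {a} ⊔ Module.annihilator A V := by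
  refine le_antisymm (fun x hx => ?_) (sup_le ?_ fun z hz v _ => Module.mem_annihilator.mp hz v)
  · obtain ⟨Y, hY⟩ := exists_comp_eq_of_ker_le (φ := DistribSMul.toLinearMap K V a)
      (ψ := DistribSMul.toLinearMap K V x) hx
    obtain ⟨y, hy⟩ := exists_forall_smul_eq hK Y
    have hxy : x - y * a ∈ Module.annihilator A V := Module.mem_annihilator.mpr fun v => by
      rw [sub_smul, mul_smul, hy, sub_eq_zero]
      exact (DFunLike.congr_fun hY v).symm
    rw [← add_sub_cancel (y * a) x]
    exact Submodule.add_mem_sup (Ideal.mem_span_singleton'.mpr ⟨y, rfl⟩) hxy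
  · exact (Ideal.span_singleton_le_iff_mem _).mpr fun v hv => hv

variable {D : Type*} [DivisionRing D] [Module D A] [IsScalarTower D A A] [Module D V]
  [IsScalarTower D A V] [Module.Finite D V]

lemma finrank_quotient_annihilatorOn
    (hK : ∀ φ : Module.End A V, ∃ c : K, ∀ v, φ v = c • v) (W : Submodule K V)
    [Module.Finite K W] :
    Module.finrank D (A ⧸ annihilatorOn A W) = Module.finrank K W * Module.finrank D V := by
  let b := Module.finBasis K W
  let w : Fin (Module.finrank K W) → V := fun i => b i
  have hspan : Submodule.span K (Set.range w) = W := by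
    have h := congrArg (Submodule.map W.subtype) b.span_eq
    rwa [Submodule.map_span, ← Set.range_comp, Submodule.map_subtype_top] at h
  have hw : LinearIndependent K w := b.linearIndependent.map' W.subtype W.ker_subtype
  have hsurj : Function.Surjective (LinearMap.toSpanSingleton A (Fin _ → V) w) := fun t =>
    (exists_smul_eq_of_linearIndependent hK hw t).imp fun a ha => funext ha
  have e := (LinearMap.quotKerEquivOfSurjective _ hsurj).restrictScalars D
  rw [ker_toSpanSingleton_eq_annihilatorOn (K := K), hspan] at e
  rw [e.finrank_eq, Module.finrank_pi_fintype, Finset.sum_const, Finset.card_univ,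
    Fintype.card_fin, smul_eq_mul]

lemma finrank_quotient_annihilator [Module.Finite K V]
    (hK : ∀ φ : Module.End A V, ∃ c : K, ∀ v, φ v = c • v) :
    Module.finrank D (A ⧸ Module.annihilator A V) = Module.finrank K V * Module.finrank D V := by
  rw [← annihilatorOn_top (K := K), finrank_quotient_annihilatorOn hK, finrank_top]

/-- Rank-nullity for `v ↦ a • v`, with the nullity counted through the double annihilator. -/
lemma finrank_range_smul_mul_add [Module.Finite K V]
    (hK : ∀ φ : Module.End A V, ∃ c : K, ∀ v, φ v = c • v) (a : A) :
    Module.finrank K (LinearMap.range (DistribSMul.toLinearMap K V a)) * Module.finrank D V +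
        Module.finrank D (A ⧸ (Ideal.span {a} ⊔ Module.annihilator A V)) =
      Module.finrank K V * Module.finrank D V := by
  rw [← annihilatorOn_ker_smul hK, finrank_quotient_annihilatorOn hK, ← add_mul,
    LinearMap.finrank_range_add_finrank_ker]

end SimpleModule

section Coefficients

variable {R : Type*} [Semiring R]

lemma coeff_finset_sum {ι : Type*} (s : Finset ι) (p : ι → SkewPolynomial R) (j : ℕ) :
    (∑ i ∈ s, p i).coeff j = ∑ i ∈ s, (p i).coeff j :=
  map_sum ({ toFun := fun q => q.coeff j, map_zero' := coeff_zero j,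
             map_add' := fun q r => coeff_add q r j } : SkewPolynomial R →+ R) p s

/-- The skew polynomial `∑ i < N, c i * X ^ i`, as a linear map in the coefficient vector `c`. -/
def ofCoeffs (N : ℕ) : (Fin N → R) →ₗ[R] SkewPolynomial R :=
  ∑ i : Fin N, monomial (i : ℕ) ∘ₗ LinearMap.proj i

lemma coeff_ofCoeffs {N : ℕ} (c : Fin N → R) (j : ℕ) :
    (ofCoeffs N c).coeff j = if h : j < N then c ⟨j, h⟩ else 0 := by
  have hsum : ofCoeffs N c = ∑ i : Fin N, monomial (i : ℕ) (c i) := by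
    simp only [ofCoeffs, LinearMap.sum_apply, LinearMap.comp_apply, LinearMap.proj_apply]
  simp only [hsum, coeff_finset_sum, coeff_monomial]
  split_ifs with h
  · rw [Finset.sum_eq_single ⟨j, h⟩ (fun i _ hi => if_neg fun hij => hi (Fin.ext hij))
      fun hj => absurd (Finset.mem_univ _) hj, if_pos rfl]
  · exact Finset.sum_eq_zero fun i _ => if_neg fun hij : (i : ℕ) = j => h (hij ▸ i.2)

variable [MulSemiringAction (Multiplicative ℕ) R]

lemma C_mul_eq_smul (a : R) (p : SkewPolynomial R) : C a * p = a • p := by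
  have h : C a = a • (1 : SkewPolynomial R) := by
    rw [← monomial_zero_one, smul_monomial, smul_eq_mul, mul_one, monomial_zero_left]
  rw [h, smul_one_mul]

lemma coeff_C_mul (a : R) (p : SkewPolynomial R) (i : ℕ) :
    (C a * p).coeff i = a * p.coeff i := by
  induction p using SkewPolynomial.induction with
  | h0 => simp
  | ha n r q _ _ hq =>
    rw [mul_add, coeff_add, hq, C_mul_monomial, coeff_monomial, coeff_add, coeff_monomial,
      mul_add, mul_ite, mul_zero]

lemma coeff_mul_C (a : R) (p : SkewPolynomial R) (i : ℕ) :
    (p * C a).coeff i = p.coeff i * φ^[i] a := by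
  induction p using SkewPolynomial.induction with
  | h0 => simp
  | ha n r q _ _ hq =>
    rw [add_mul, coeff_add, hq, monomial_mul_C, coeff_monomial, coeff_add, coeff_monomial]
    split_ifs with h
    · rw [h, add_mul]
    · rw [zero_add, zero_add]

lemma coeff_X_mul_zero (p : SkewPolynomial R) : (X * p).coeff 0 = 0 := by
  induction p using SkewPolynomial.induction with
  | h0 => simp
  | ha n r q _ _ hq => rw [mul_add, coeff_add, hq, X_mul_monomial, coeff_monomial_succ, add_zero]

lemma coeff_X_mul_succ (p : SkewPolynomial R) (i : ℕ) :
    (X * p).coeff (i + 1) = φ (p.coeff i) := by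
  induction p using SkewPolynomial.induction with
  | h0 => simp
  | ha n r q _ _ hq =>
    rw [mul_add, coeff_add, hq, X_mul_monomial, coeff_monomial, coeff_add, coeff_monomial, map_add]
    simp only [Nat.add_right_cancel_iff, apply_ite φ, map_zero]

lemma coeff_mul_X_zero (p : SkewPolynomial R) : (p * X).coeff 0 = 0 := by
  induction p using SkewPolynomial.induction with
  | h0 => simp
  | ha n r q _ _ hq => rw [add_mul, coeff_add, hq, monomial_mul_X, coeff_monomial_succ, add_zero]

lemma coeff_mul_X_succ (p : SkewPolynomial R) (i : ℕ) :
    (p * X).coeff (i + 1) = p.coeff i := by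
  induction p using SkewPolynomial.induction with
  | h0 => simp
  | ha n r q _ _ hq =>
    rw [add_mul, coeff_add, hq, monomial_mul_X, coeff_monomial, coeff_add, coeff_monomial]
    simp

lemma mem_center_iff_coeff {R : Type*} [Ring R] [MulSemiringAction (Multiplicative ℕ) R]
    {p : SkewPolynomial R} :
    p ∈ Subring.center (SkewPolynomial R) ↔
      (∀ a i, p.coeff i * φ^[i] a = a * p.coeff i) ∧ ∀ i, φ (p.coeff i) = p.coeff i := by
  constructor
  · intro hp
    rw [Subring.mem_center_iff] at hp
    refine ⟨fun a i => ?_, fun i => ?_⟩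
    · rw [← coeff_mul_C, ← coeff_C_mul, hp]
    · rw [← coeff_X_mul_succ, hp, coeff_mul_X_succ]
  · rintro ⟨hC, hX⟩
    have hpC (a : R) : Commute (C a) p := by
      ext i
      rw [coeff_mul_C, coeff_C_mul, hC]
    have hpX : Commute X p := by
      ext i
      cases i with
      | zero => rw [coeff_X_mul_zero, coeff_mul_X_zero]
      | succ i => rw [coeff_X_mul_succ, coeff_mul_X_succ, hX]
    rw [Subring.mem_center_iff]
    intro q
    induction q using SkewPolynomial.induction with
    | h0 => rw [zero_mul, mul_zero]
    | ha n r q _ _ hq =>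
      rw [add_mul, mul_add, hq, ← C_mul_X_pow_eq_monomial,
        ((hpC r).mul_left (hpX.pow_left n)).eq]

end Coefficients

section Degree

variable {D : Type*} [DivisionRing D]

lemma natDeg_eq_of_deg_eq {p : SkewPolynomial D} {m : ℕ} (h : deg p = m) : natDeg p = m := by
  simp [natDeg, h]

lemma natDeg_eq_of_coeff {p : SkewPolynomial D} {m : ℕ} (hm : p.coeff m ≠ 0)
    (h : ∀ i, m < i → p.coeff i = 0) : natDeg p = m := by
  have hp : p ≠ 0 := fun hp => hm (by rw [hp, coeff_zero])
  refine le_antisymm ?_ ?_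
  · by_contra! hlt
    exact coeff_natDeg_ne_zero hp (h _ hlt)
  · by_contra! hlt
    exact hm (coeff_eq_zero_of_natDeg_lt hlt)

variable [MulSemiringAction (Multiplicative ℕ) D]

lemma natDeg_C_mul {a : D} (ha : a ≠ 0) (p : SkewPolynomial D) :
    natDeg (C a * p) = natDeg p := by
  obtain rfl | hp := eq_or_ne p 0
  · rw [mul_zero]
  · refine natDeg_eq_of_coeff ?_ fun i hi => ?_
    · rw [coeff_C_mul]
      exact mul_ne_zero ha (coeff_natDeg_ne_zero hp)
    · rw [coeff_C_mul, coeff_eq_zero_of_natDeg_lt hi, mul_zero]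

lemma isMonic_C_inv_mul {p : SkewPolynomial D} (hp : p ≠ 0) :
    IsMonic (C (p.coeff (natDeg p))⁻¹ * p) := by
  have hlead := coeff_natDeg_ne_zero hp
  rw [IsMonic, natDeg_C_mul (inv_ne_zero hlead), coeff_C_mul, inv_mul_cancel₀ hlead]

lemma span_singleton_C_mul {a : D} (ha : a ≠ 0) (p : SkewPolynomial D) :
    Ideal.span {C a * p} = Ideal.span {p} := by
  refine le_antisymm ?_ ?_
  · exact (Ideal.span_singleton_le_iff_mem _).mpr (Ideal.mem_span_singleton'.mpr ⟨_, rfl⟩)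
  · refine (Ideal.span_singleton_le_iff_mem _).mpr (Ideal.mem_span_singleton'.mpr ⟨C a⁻¹, ?_⟩)
    rw [← mul_assoc, ← C_mul, inv_mul_cancel₀ ha, C_1, one_mul]

end Degree

section LeftIdeals

variable {D : Type*} [DivisionRing D] [MulSemiringAction (Multiplicative ℕ) D]

lemma exists_isMonic_span_eq_span {p : SkewPolynomial D} (hp : p ≠ 0) :
    ∃ g, IsMonic g ∧ natDeg g = natDeg p ∧ Ideal.span {g} = Ideal.span {p} := by
  have hlead := inv_ne_zero (coeff_natDeg_ne_zero hp)
  exact ⟨_, isMonic_C_inv_mul hp, natDeg_C_mul hlead p, span_singleton_C_mul hlead p⟩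

lemma exists_isMonic_eq_span_singleton {I : Ideal (SkewPolynomial D)} (hI : I ≠ ⊥) :
    ∃ g, IsMonic g ∧ I = Ideal.span {g} := by
  classical
  have hex : ∃ N : ℕ, ∃ p ∈ I, p ≠ 0 ∧ natDeg p = N := by
    obtain ⟨p, hp, hp0⟩ := Submodule.exists_mem_ne_zero_of_ne_bot hI
    exact ⟨_, p, hp, hp0, rfl⟩
  obtain ⟨p, hp, hp0, hN⟩ := Nat.find_spec hex
  obtain ⟨g, hg, hdeg, hspan⟩ := exists_isMonic_span_eq_span hp0
  have hgI : Ideal.span {g} ≤ I := by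
    rwa [hspan, Ideal.span_singleton_le_iff_mem]
  refine ⟨g, hg, le_antisymm (fun x hx => ?_) hgI⟩
  obtain ⟨r, hr, hxr⟩ := exists_rem hg x
  have hrI : r ∈ I := by
    rw [← sub_sub_cancel x r]
    exact sub_mem hx (hgI hxr)
  have hr0 : r = 0 := by
    by_contra hr0
    rw [deg_eq_natDeg hr0, deg_eq_natDeg hg.ne_zero, hdeg, hN, Nat.cast_lt] at hr
    exact Nat.find_min hex hr ⟨r, hrI, hr0, rfl⟩
  rwa [hr0, sub_zero] at hxr

lemma exists_eq_span_singleton (I : Ideal (SkewPolynomial D)) : ∃ g, I = Ideal.span {g} := by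
  obtain rfl | hI := eq_or_ne I ⊥
  · exact ⟨0, Ideal.span_singleton_zero.symm⟩
  · obtain ⟨g, -, hg⟩ := exists_isMonic_eq_span_singleton hI
    exact ⟨g, hg⟩

lemma rightDvd_iff_mem_span {g a : SkewPolynomial D} : RightDvd g a ↔ a ∈ Ideal.span {g} := by
  rw [Ideal.mem_span_singleton', RightDvd]
  exact exists_congr fun q => eq_comm

lemma isGCRD_of_span_eq {g a b : SkewPolynomial D} (h : Ideal.span {g} = Ideal.span {a, b}) :
    IsGCRD g a b := by
  simp only [IsGCRD, rightDvd_iff_mem_span]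
  refine ⟨?_, ?_, fun e ha hb => ?_⟩
  · exact h ▸ Ideal.subset_span (Set.mem_insert a {b})
  · exact h ▸ Ideal.subset_span (Set.mem_insert_of_mem a rfl)
  · rw [← Ideal.span_singleton_le_iff_mem, h, Ideal.span_le, Set.pair_subset_iff]
    exact ⟨ha, hb⟩

lemma exists_isGCRD (a b : SkewPolynomial D) : ∃ g, IsGCRD g a b :=
  (exists_eq_span_singleton (Ideal.span {a, b})).imp fun _ hg => isGCRD_of_span_eq hg.symm

lemma IsGCRD.span_eq {g a b : SkewPolynomial D} (h : IsGCRD g a b) :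
    Ideal.span {g} = Ideal.span {a, b} := by
  obtain ⟨g', hg'⟩ := exists_eq_span_singleton (Ideal.span {a, b})
  obtain ⟨ha, hb, -⟩ := isGCRD_of_span_eq hg'.symm
  refine le_antisymm ?_ ?_
  · rw [hg', Ideal.span_singleton_le_iff_mem, ← rightDvd_iff_mem_span]
    exact h.2.2 g' ha hb
  · rw [Ideal.span_le, Set.pair_subset_iff]
    exact ⟨rightDvd_iff_mem_span.mp h.1, rightDvd_iff_mem_span.mp h.2.1⟩

end LeftIdeals

section Dimension

variable {D : Type*} [DivisionRing D]

lemma deg_ofCoeffs_lt {N : ℕ} (c : Fin N → D) : deg (ofCoeffs N c) < N := by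
  rw [deg_lt_iff]
  intro i hi
  rw [coeff_ofCoeffs, dif_neg hi.not_gt]

lemma ofCoeffs_coeff {N : ℕ} {p : SkewPolynomial D} (hp : deg p < N) :
    ofCoeffs N (fun i => p.coeff i) = p := by
  ext j
  rw [coeff_ofCoeffs]
  split_ifs with h
  · rfl
  · exact ((deg_lt_iff p N).mp hp j (not_lt.mp h)).symm

variable [MulSemiringAction (Multiplicative ℕ) D]

lemma bijective_mkQ_comp_ofCoeffs {g : SkewPolynomial D} (hg : IsMonic g) :
    Function.Bijective
      ((Ideal.span {g}).mkQ.restrictScalars D ∘ₗ ofCoeffs (natDeg g)) := by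
  have hdeg := deg_eq_natDeg hg.ne_zero
  constructor
  · rw [injective_iff_map_eq_zero]
    intro c hc
    have h0 : ofCoeffs (natDeg g) c = 0 :=
      eq_zero_of_deg_lt hg ((Submodule.Quotient.mk_eq_zero _).mp hc) (hdeg ▸ deg_ofCoeffs_lt c)
    ext i
    have hi := coeff_ofCoeffs c i
    rwa [h0, coeff_zero, dif_pos i.2, eq_comm] at hi
  · intro y
    obtain ⟨p, rfl⟩ := Submodule.mkQ_surjective _ y
    obtain ⟨r, hr, hpr⟩ := exists_rem hg p
    refine ⟨fun i => r.coeff i, ?_⟩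
    rw [LinearMap.comp_apply, ofCoeffs_coeff (hdeg ▸ hr)]
    exact ((Submodule.Quotient.eq _).mpr hpr).symm

lemma finrank_quotient_span_singleton {g : SkewPolynomial D} (hg : g ≠ 0) :
    Module.finrank D (SkewPolynomial D ⧸ Ideal.span {g}) = natDeg g := by
  obtain ⟨p, hp, hdeg, hspan⟩ := exists_isMonic_span_eq_span hg
  rw [← hspan, ← (LinearEquiv.ofBijective _ (bijective_mkQ_comp_ofCoeffs hp)).finrank_eq,
    Module.finrank_fin_fun, hdeg]

lemma finite_quotient_span_singleton {g : SkewPolynomial D} (hg : g ≠ 0) :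
    Module.Finite D (SkewPolynomial D ⧸ Ideal.span {g}) := by
  obtain ⟨p, hp, -, hspan⟩ := exists_isMonic_span_eq_span hg
  rw [← hspan]
  exact Module.Finite.equiv (LinearEquiv.ofBijective _ (bijective_mkQ_comp_ofCoeffs hp))

end Dimension

section Center

variable {D : Type*} [DivisionRing D] [MulSemiringAction (Multiplicative ℕ) D]

variable {g : SkewPolynomial D}

lemma eq_C_mul_of_mem_span {p : SkewPolynomial D} (hg : IsMonic g) (hp : p ∈ Ideal.span {g})
    (hdeg : ∀ i, natDeg g < i → p.coeff i = 0) : p = C (p.coeff (natDeg g)) * g := by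
  refine sub_eq_zero.mp (eq_zero_of_deg_lt hg
    (sub_mem hp (Ideal.mem_span_singleton'.mpr ⟨_, rfl⟩)) ?_)
  rw [deg_eq_natDeg hg.ne_zero, deg_lt_iff]
  intro i hi
  rw [coeff_sub, coeff_C_mul]
  rcases hi.eq_or_lt with rfl | hlt
  · rw [hg, mul_one, sub_self]
  · rw [hdeg i hlt, coeff_eq_zero_of_natDeg_lt hlt, mul_zero, sub_zero]

variable [(Ideal.span {g}).IsTwoSided]

lemma mul_C_eq_C_mul_of_isTwoSided (hg : IsMonic g) (a : D) :
    g * C a = C (φ^[natDeg g] a) * g := by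
  have hmem : g * C a ∈ Ideal.span {g} :=
    Ideal.mul_mem_right _ _ (Ideal.mem_span_singleton_self g)
  have hlead : (g * C a).coeff (natDeg g) = φ^[natDeg g] a := by
    rw [coeff_mul_C, hg, one_mul]
  rw [← hlead]
  refine eq_C_mul_of_mem_span hg hmem fun i hi => ?_
  rw [coeff_mul_C, coeff_eq_zero_of_natDeg_lt hi, zero_mul]

lemma X_mul_eq_mul_X_of_isTwoSided (hg : IsMonic g) (hg0 : g.coeff 0 ≠ 0) : X * g = g * X := by
  set w := X * g - g * X with hw
  have hmem : w ∈ Ideal.span {g} :=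
    sub_mem (Ideal.mul_mem_left _ _ (Ideal.mem_span_singleton_self g))
      (Ideal.mul_mem_right _ _ (Ideal.mem_span_singleton_self g))
  have hdeg : ∀ i, natDeg g < i → w.coeff i = 0 := by
    rintro (_ | i) hi
    · exact absurd hi (Nat.not_lt_zero _)
    rw [hw, coeff_sub, coeff_X_mul_succ, coeff_mul_X_succ]
    rcases (Nat.lt_succ_iff.mp hi).eq_or_lt with rfl | hlt
    · rw [hg, map_one, sub_self]
    · rw [coeff_eq_zero_of_natDeg_lt hlt, map_zero, sub_self]
  have hwg := eq_C_mul_of_mem_span hg hmem hdeg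
  have hlead : w.coeff (natDeg g) * g.coeff 0 = 0 := by
    rw [← coeff_C_mul, ← hwg, hw, coeff_sub, coeff_X_mul_zero, coeff_mul_X_zero, sub_self]
  rw [(mul_eq_zero.mp hlead).resolve_right hg0, C_0, zero_mul] at hwg
  exact sub_eq_zero.mp hwg

lemma C_inv_mul_mem_center_of_isTwoSided (hg : IsMonic g) (hg0 : g.coeff 0 ≠ 0) :
    C (g.coeff 0)⁻¹ * g ∈ Subring.center (SkewPolynomial D) := by
  have hcomm (a : D) (i : ℕ) : g.coeff i * φ^[i] a = φ^[natDeg g] a * g.coeff i := by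
    rw [← coeff_mul_C, mul_C_eq_C_mul_of_isTwoSided hg, coeff_C_mul]
  have hfix (i : ℕ) : φ (g.coeff i) = g.coeff i := by
    rw [← coeff_X_mul_succ, X_mul_eq_mul_X_of_isTwoSided hg hg0, coeff_mul_X_succ]
  refine mem_center_iff_coeff.mpr ⟨fun a i => ?_, fun i => ?_⟩
  · have h0 : (g.coeff 0)⁻¹ * φ^[natDeg g] a = a * (g.coeff 0)⁻¹ := by
      rw [inv_mul_eq_iff_eq_mul₀ hg0, ← mul_assoc, eq_mul_inv_iff_mul_eq₀ hg0]
      exact (hcomm a 0).symm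
    rw [coeff_C_mul, mul_assoc, hcomm, ← mul_assoc, h0, mul_assoc]
  · rw [coeff_C_mul, map_mul, map_inv₀, hfix, hfix]

end Center

section InnerPower

variable {D : Type*} [DivisionRing D] [MulSemiringAction (Multiplicative ℕ) D]

/-- `σ` is the automorphism defining `D[t;σ]`, and its power `σⁿ` with `0 < n` is the conjugation
by the `σ`-fixed unit `u`. -/
structure IsInnerPower (σ : D ≃+* D) (n : ℕ) (u : D) : Prop where
  ofAdd_one_smul : ∀ z : D, (Multiplicative.ofAdd 1 : Multiplicative ℕ) • z = σ z
  pos : 0 < n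
  ne_zero : u ≠ 0
  map_eq : σ u = u
  iterate_eq : ∀ z : D, σ^[n] z = u * z * u⁻¹

/-- The exponent `n` in `IsInnerPower σ n u` is the order of `σ` modulo inner automorphisms. -/
structure IsInnerOrder (σ : D ≃+* D) (n : ℕ) (u : D) : Prop extends IsInnerPower σ n u where
  not_inner : ∀ j : ℕ, 0 < j → j < n → ¬ ∃ v : D, v ≠ 0 ∧ ∀ z : D, σ^[j] z = v * z * v⁻¹

variable {σ : D ≃+* D} {n : ℕ} {u : D}

lemma IsInnerPower.φ_iterate (hσ : IsInnerPower σ n u) (i : ℕ) : (φ^[i] : D → D) = σ^[i] :=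
  congrArg (·^[i]) (funext hσ.ofAdd_one_smul)

lemma IsInnerPower.iterate_mul_eq (hσ : IsInnerPower σ n u) (j : ℕ) (z : D) :
    σ^[n * j] z = u ^ j * z * (u ^ j)⁻¹ := by
  induction j generalizing z with
  | zero => simp
  | succ j ih =>
    rw [mul_add_one, Function.iterate_add_apply, hσ.iterate_eq, ih, pow_succ, mul_inv_rev]
    simp only [mul_assoc]

lemma IsInnerOrder.dvd_of_iterate_eq (hσ : IsInnerOrder σ n u) {i : ℕ} {v : D} (hv : v ≠ 0)
    (hi : ∀ z : D, σ^[i] z = v * z * v⁻¹) : n ∣ i := by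
  by_contra hdvd
  have huq : u ^ (i / n) ≠ 0 := pow_ne_zero _ hσ.ne_zero
  refine hσ.not_inner (i % n) (Nat.pos_of_ne_zero fun h => hdvd (Nat.dvd_of_mod_eq_zero h))
    (Nat.mod_lt _ hσ.pos) ⟨v * (u ^ (i / n))⁻¹, mul_ne_zero hv (inv_ne_zero huq), fun z => ?_⟩
  have h := hi ((u ^ (i / n))⁻¹ * z * u ^ (i / n))
  rw [← Nat.mod_add_div i n, Function.iterate_add_apply, hσ.iterate_mul_eq, Nat.mod_add_div] at h
  rw [mul_assoc _⁻¹, mul_inv_cancel_left₀ huq, mul_inv_cancel_right₀ huq] at h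
  rw [h, mul_inv_rev, inv_inv]
  simp only [mul_assoc]

lemma IsInnerPower.C_mul_X_pow_pow (hσ : IsInnerPower σ n u) (j : ℕ) :
    (C u⁻¹ * X ^ n : SkewPolynomial D) ^ j = monomial (n * j) (u⁻¹ ^ j) := by
  have hfix (i : ℕ) : σ^[i] u⁻¹ = u⁻¹ := Function.iterate_fixed (by rw [map_inv₀, hσ.map_eq]) i
  rw [C_mul_X_pow_eq_monomial]
  induction j with
  | zero => simp [C_1]
  | succ j ih =>
    rw [pow_succ, ih, monomial_mul_monomial, hσ.φ_iterate, hfix, mul_add_one, pow_succ]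

lemma IsInnerPower.coeff_evalCentral (hσ : IsInnerPower σ n u) (p : Polynomial (fixedCenter σ))
    (i : ℕ) : (evalCentral σ n u p).coeff i =
      if n ∣ i then ((p.coeff (i / n) : Subring.center D) : D) * u⁻¹ ^ (i / n) else 0 := by
  have hsum : evalCentral σ n u p =
      ∑ j ∈ p.support, C ((p.coeff j : Subring.center D) : D) * (C u⁻¹ * X ^ n) ^ j := by
    rw [evalCentral, Polynomial.eval₂_eq_sum, Polynomial.sum_def]
    rfl
  simp only [hsum, coeff_finset_sum, hσ.C_mul_X_pow_pow, coeff_C_mul, coeff_monomial]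
  split_ifs with h
  · obtain ⟨l, rfl⟩ := h
    rw [Nat.mul_div_cancel_left _ hσ.pos, Finset.sum_eq_single l, if_pos rfl]
    · intro j _ hj
      rw [if_neg fun h' => hj (Nat.eq_of_mul_eq_mul_left hσ.pos h'), mul_zero]
    · intro hl
      rw [Polynomial.notMem_support_iff.mp hl]
      simp
  · refine Finset.sum_eq_zero fun j _ => ?_
    rw [if_neg fun h' => h ⟨j, h'.symm⟩, mul_zero]

lemma IsInnerPower.coeff_evalCentral_mul (hσ : IsInnerPower σ n u)
    (p : Polynomial (fixedCenter σ)) (j : ℕ) :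
    (evalCentral σ n u p).coeff (n * j) = ((p.coeff j : Subring.center D) : D) * u⁻¹ ^ j := by
  rw [hσ.coeff_evalCentral, if_pos (dvd_mul_right n j), Nat.mul_div_cancel_left _ hσ.pos]

lemma IsInnerPower.coeff_evalCentral_natDegree_ne_zero (hσ : IsInnerPower σ n u)
    {p : Polynomial (fixedCenter σ)} (hp : p ≠ 0) :
    (evalCentral σ n u p).coeff (n * p.natDegree) ≠ 0 := by
  have hlead := Polynomial.leadingCoeff_ne_zero.mpr hp
  rw [hσ.coeff_evalCentral_mul]
  exact mul_ne_zero (by simpa using hlead) (pow_ne_zero _ (inv_ne_zero hσ.ne_zero))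

lemma IsInnerPower.evalCentral_ne_zero (hσ : IsInnerPower σ n u)
    {p : Polynomial (fixedCenter σ)} (hp : p ≠ 0) : evalCentral σ n u p ≠ 0 := fun h0 =>
  hσ.coeff_evalCentral_natDegree_ne_zero hp (by rw [h0, coeff_zero])

lemma IsInnerPower.natDeg_evalCentral (hσ : IsInnerPower σ n u)
    (p : Polynomial (fixedCenter σ)) : natDeg (evalCentral σ n u p) = n * p.natDegree := by
  obtain rfl | hp := eq_or_ne p 0
  · simp [evalCentral, natDeg, deg]
  refine natDeg_eq_of_coeff (hσ.coeff_evalCentral_natDegree_ne_zero hp) fun i hi => ?_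
  rw [hσ.coeff_evalCentral]
  split_ifs with h
  · obtain ⟨l, rfl⟩ := h
    rw [Nat.mul_div_cancel_left _ hσ.pos,
      Polynomial.coeff_eq_zero_of_natDegree_lt (lt_of_mul_lt_mul_left hi n.zero_le)]
    simp
  · rfl

lemma IsInnerPower.evalCentral_mem_center (hσ : IsInnerPower σ n u)
    (p : Polynomial (fixedCenter σ)) :
    evalCentral σ n u p ∈ Subring.center (SkewPolynomial D) := by
  refine mem_center_iff_coeff.mpr ⟨fun a i => ?_, fun i => ?_⟩
  · rw [hσ.coeff_evalCentral, hσ.φ_iterate]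
    split_ifs with h
    · obtain ⟨j, rfl⟩ := h
      rw [hσ.iterate_mul_eq, inv_pow, mul_assoc, mul_assoc (u ^ _),
        Nat.mul_div_cancel_left _ hσ.pos, inv_mul_cancel_left₀ (pow_ne_zero _ hσ.ne_zero),
        ← mul_assoc, ← mul_assoc, Subring.mem_center_iff.mp (p.coeff j : Subring.center D).2 a]
    · rw [zero_mul, mul_zero]
  · have hφ : ∀ z : D, φ z = σ z := hσ.ofAdd_one_smul
    rw [hσ.coeff_evalCentral, hφ]
    split_ifs
    · rw [map_mul, map_pow, map_inv₀, hσ.map_eq]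
      exact congrArg (· * _) (p.coeff (i / n)).2
    · exact map_zero σ

/-- Evaluation at `u⁻¹tⁿ`, as a ring homomorphism from `F[x]` to the center of `D[t;σ]`. -/
def IsInnerPower.evalCentralHom (hσ : IsInnerPower σ n u) :
    Polynomial (fixedCenter σ) →+* Subring.center (SkewPolynomial D) :=
  have hC (c : fixedCenter σ) : C ((c : Subring.center D) : D) ∈ Subring.center _ := by
    have hc : evalCentral σ n u (Polynomial.C c) = C ((c : Subring.center D) : D) :=
      Polynomial.eval₂_C _ _
    exact hc ▸ hσ.evalCentral_mem_center (Polynomial.C c)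
  (Polynomial.eval₂RingHom'
      ((CRingHom.comp (Subring.center D).subtype).comp (fixedCenter σ).subtype)
      (C u⁻¹ * X ^ n)
      fun c => (Subring.mem_center_iff.mp (hC c) (C u⁻¹ * X ^ n)).symm).codRestrict _
    hσ.evalCentral_mem_center

lemma IsInnerPower.coe_evalCentralHom (hσ : IsInnerPower σ n u) (p : Polynomial (fixedCenter σ)) :
    (hσ.evalCentralHom p : SkewPolynomial D) = evalCentral σ n u p :=
  rfl

lemma IsInnerOrder.evalCentralHom_surjective (hσ : IsInnerOrder σ n u) :
    Function.Surjective hσ.evalCentralHom := by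
  rintro ⟨x, hx⟩
  obtain ⟨hcomm, hfix⟩ := mem_center_iff_coeff.mp hx
  have hφ : ∀ z : D, φ z = σ z := hσ.ofAdd_one_smul
  simp only [hσ.φ_iterate, hφ] at hcomm hfix
  have hdvd (i : ℕ) (hi : x.coeff i ≠ 0) : n ∣ i := by
    refine hσ.dvd_of_iterate_eq (inv_ne_zero hi) fun z => ?_
    rw [inv_inv, mul_assoc, ← hcomm, inv_mul_cancel_left₀ hi]
  have hcenter (j : ℕ) : x.coeff (n * j) * u ^ j ∈ Subring.center D := by
    rw [Subring.mem_center_iff]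
    intro a
    rw [← mul_assoc, ← hcomm a (n * j), hσ.iterate_mul_eq, mul_assoc, mul_assoc,
      inv_mul_cancel₀ (pow_ne_zero _ hσ.ne_zero), mul_one, mul_assoc]
  let c (j : ℕ) : fixedCenter σ := ⟨⟨x.coeff (n * j) * u ^ j, hcenter j⟩, by
    change σ (x.coeff (n * j) * u ^ j) = x.coeff (n * j) * u ^ j
    rw [map_mul, map_pow, hfix, hσ.map_eq]⟩
  have hc (j : ℕ) (hj : natDeg x < j) : c j = 0 := Subtype.ext <| Subtype.ext <| by
    change x.coeff (n * j) * u ^ j = 0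
    rw [coeff_eq_zero_of_natDeg_lt (hj.trans_le (Nat.le_mul_of_pos_left j hσ.pos)), zero_mul]
  let p := ∑ j ∈ Finset.range (natDeg x + 1), Polynomial.monomial j (c j)
  have hp (j : ℕ) : p.coeff j = c j := by
    simp only [p, Polynomial.finsetSum_coeff, Polynomial.coeff_monomial, Finset.sum_ite_eq',
      Finset.mem_range]
    exact ite_eq_left_iff.mpr fun hj => (hc j (by lia)).symm
  refine ⟨p, Subtype.ext (SkewPolynomial.ext fun i => ?_)⟩
  by_cases h : n ∣ i
  · obtain ⟨j, rfl⟩ := h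
    rw [hσ.coe_evalCentralHom, hσ.coeff_evalCentral_mul, hp, inv_pow]
    exact mul_inv_cancel_right₀ (pow_ne_zero j hσ.ne_zero) _
  · rw [hσ.coe_evalCentralHom, hσ.coeff_evalCentral, if_neg h]
    by_contra hne
    exact h (hdvd i (Ne.symm hne))

end InnerPower

section Petit

variable {D : Type*} [DivisionRing D] [MulSemiringAction (Multiplicative ℕ) D]

lemma IsMonic.natDeg_pos {f : SkewPolynomial D} (hf : IsMonic f) (hu : ¬ IsUnit f) :
    0 < natDeg f := by
  by_contra! h0
  have hdeg : natDeg f = 0 := Nat.le_zero.mp h0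
  refine hu ((?_ : f = 1) ▸ isUnit_one)
  ext i
  rcases i.eq_zero_or_pos with rfl | hi
  · rw [coeff_one, if_pos rfl]
    exact hdeg ▸ hf
  · rw [coeff_one, if_neg hi.ne, coeff_eq_zero_of_natDeg_lt (hdeg.trans_lt hi)]

lemma exists_eq_X_mul (hφ : Function.Surjective (φ : D → D)) {p : SkewPolynomial D}
    (h0 : p.coeff 0 = 0) : ∃ q, deg q < natDeg p ∧ p = X * q := by
  obtain ⟨τ, hτ⟩ := hφ.hasRightInverse
  refine ⟨ofCoeffs (natDeg p) fun i => τ (p.coeff (i + 1)), deg_ofCoeffs_lt _, ?_⟩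
  ext i
  cases i with
  | zero => rw [h0, coeff_X_mul_zero]
  | succ i =>
    rw [coeff_X_mul_succ, coeff_ofCoeffs]
    split_ifs with hi
    · exact (hτ _).symm
    · rw [map_zero, coeff_eq_zero_of_natDeg_lt (by lia)]

namespace PetitAlgebra

variable {f : SkewPolynomial D} {hf : IsMonic f}

instance : Module D (PetitAlgebra f hf) :=
  inferInstanceAs (Module D (SkewPolynomial D ⧸ Ideal.span {f}))

instance : IsScalarTower D (SkewPolynomial D) (PetitAlgebra f hf) :=
  inferInstanceAs (IsScalarTower D (SkewPolynomial D) (SkewPolynomial D ⧸ Ideal.span {f}))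

instance : Module.Finite D (PetitAlgebra f hf) :=
  finite_quotient_span_singleton hf.ne_zero

lemma finrank_eq : Module.finrank D (PetitAlgebra f hf) = natDeg f :=
  finrank_quotient_span_singleton hf.ne_zero

lemma C_smul (c : D) (v : PetitAlgebra f hf) : (C c : SkewPolynomial D) • v = c • v := by
  rw [← mul_one (C c), C_mul_eq_smul, smul_assoc, one_smul]

lemma smul_one_eq_mk (a : SkewPolynomial D) : a • (1 : PetitAlgebra f hf) = mk f hf a := by
  rw [one_def, ← map_smul, smul_eq_mul, mul_one]

lemma mk_ne_zero {a : SkewPolynomial D} (ha : a ≠ 0) (hdeg : deg a < natDeg f) :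
    mk f hf a ≠ 0 := fun h =>
  ha (eq_zero_of_deg_lt hf ((mk_eq_zero f hf).mp h) ((deg_eq_natDeg hf.ne_zero).symm ▸ hdeg))

lemma one_ne_zero (hu : ¬ IsUnit f) : (1 : PetitAlgebra f hf) ≠ 0 := by
  refine mk_ne_zero _root_.one_ne_zero ((deg_lt_iff _ _).mpr fun i hi => ?_)
  rw [coeff_one, if_neg ((hf.natDeg_pos hu).trans_le hi).ne]

lemma isSimpleModule (hirr : Irreducible f) :
    IsSimpleModule (SkewPolynomial D) (PetitAlgebra f hf) := by
  refine isSimpleModule_iff_isCoatom.mpr (⟨fun h => ?_, fun I hI => ?_⟩ : IsCoatom (Ideal.span {f}))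
  · exact one_ne_zero hirr.not_isUnit ((mk_eq_zero f hf).mpr (h ▸ Submodule.mem_top))
  · obtain ⟨g, rfl⟩ := exists_eq_span_singleton I
    obtain ⟨q, hq⟩ := Ideal.mem_span_singleton'.mp (hI.le (Ideal.mem_span_singleton_self f))
    rcases hirr.isUnit_or_isUnit hq.symm with ⟨v, rfl⟩ | hg
    · refine absurd ((Ideal.span_singleton_le_iff_mem _).mpr ?_) hI.not_ge
      exact Ideal.mem_span_singleton'.mpr ⟨↑v⁻¹, by rw [← hq, Units.inv_mul_cancel_left]⟩
    · exact Ideal.eq_top_of_isUnit_mem _ (Ideal.mem_span_singleton_self g) hg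

lemma smul_mul_nucleus_of_deg_lt (z : NucR f hf) {a : SkewPolynomial D} (ha : deg a < natDeg f)
    (y : PetitAlgebra f hf) : (a • y) * (z : PetitAlgebra f hf) = a • (y * z) := by
  have hmul (y : PetitAlgebra f hf) : mk f hf a * y = a • y := by
    rw [mul_eq_smul, rep_unique f hf ((deg_eq_natDeg hf.ne_zero).symm ▸ ha) rfl]
  rw [← hmul, ← hmul]
  exact z.2 _ _

lemma smul_mul_nucleus (hm : 1 < natDeg f) (z : NucR f hf) (a : SkewPolynomial D)
    (y : PetitAlgebra f hf) : (a • y) * (z : PetitAlgebra f hf) = a • (y * z) := by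
  have hC (c : D) (y : PetitAlgebra f hf) : (C c • y) * (z : PetitAlgebra f hf) = C c • (y * z) :=
    smul_mul_nucleus_of_deg_lt z
      ((deg_lt_iff _ _).mpr fun i hi => coeff_C_ne_zero (by lia)) y
  have hX (n : ℕ) : ∀ y : PetitAlgebra f hf,
      ((X ^ n : SkewPolynomial D) • y) * (z : PetitAlgebra f hf) =
        (X ^ n : SkewPolynomial D) • (y * z) := by
    induction n with
    | zero => simp
    | succ n ih =>
      intro y
      rw [pow_succ, mul_smul, ih, mul_smul, smul_mul_nucleus_of_deg_lt z]
      exact (deg_lt_iff _ _).mpr fun i hi => coeff_X_of_ne_one (by lia)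
  induction a using SkewPolynomial.induction with
  | h0 => simp
  | ha n r q _ _ hq =>
    rw [add_smul, add_mul, hq, ← C_mul_X_pow_eq_monomial, mul_smul, hC, hX, ← mul_smul, ← add_smul]

lemma op_smul_def (z : (NucR f hf)ᵐᵒᵖ) (y : PetitAlgebra f hf) :
    z • y = y * (z.unop : PetitAlgebra f hf) := rfl

lemma smulCommClass (hm : 1 < natDeg f) :
    SMulCommClass (SkewPolynomial D) (NucR f hf)ᵐᵒᵖ (PetitAlgebra f hf) :=
  ⟨fun a z y => (smul_mul_nucleus hm z.unop a y).symm⟩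

instance : FaithfulSMul (NucR f hf)ᵐᵒᵖ (PetitAlgebra f hf) :=
  ⟨fun {z w} h => by
    have h1 := h 1
    rw [op_smul_def, op_smul_def, one_mul, one_mul] at h1
    exact MulOpposite.unop_injective (Subtype.ext h1)⟩

lemma exists_nucleus_smul_eq (ψ : Module.End (SkewPolynomial D) (PetitAlgebra f hf)) :
    ∃ z : (NucR f hf)ᵐᵒᵖ, ∀ v, ψ v = z • v := by
  have h : ∀ v, ψ v = v * ψ 1 := by
    intro v
    rw [mul_eq_smul, ← map_smul, smul_one_eq_mk, mk_rep]
  refine ⟨MulOpposite.op ⟨ψ 1, fun x y => ?_⟩, h⟩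
  rw [← h, ← h, mul_eq_smul, map_smul, mul_eq_smul]

lemma eq_zero_of_X_smul_eq_zero (hm : 1 < natDeg f) (hirr : Irreducible f)
    {v : PetitAlgebra f hf} (hv : (X : SkewPolynomial D) • v = 0) : v = 0 := by
  by_contra hv0
  have := isSimpleModule (hf := hf) hirr
  obtain ⟨a, ha : a • v = 1⟩ :=
    IsSimpleModule.toSpanSingleton_surjective (SkewPolynomial D) hv0 1
  have hX : mk f hf X = 0 := by
    rw [← smul_one_eq_mk, ← ha, ← mul_smul, X_mul, mul_smul, hv, smul_zero]
  exact mk_ne_zero X_ne_zero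
    ((deg_lt_iff _ _).mpr fun i hi => coeff_X_of_ne_one (by lia)) hX

lemma mul_mk_center (c : Subring.center (SkewPolynomial D)) (x : PetitAlgebra f hf) :
    x * mk f hf c = (c : SkewPolynomial D) • x := by
  have hcomm := Subring.mem_center_iff.mp c.2 (rep f hf x)
  rw [mul_eq_smul, ← smul_one_eq_mk, ← mul_smul, hcomm, mul_smul, smul_one_eq_mk, mk_rep]

lemma coeff_zero_ne_zero_of_annihilator_eq_span (hφ : Function.Surjective (φ : D → D))
    (hm : 1 < natDeg f) (hirr : Irreducible f) {g : SkewPolynomial D} (hg : IsMonic g)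
    (hann : Module.annihilator (SkewPolynomial D) (PetitAlgebra f hf) = Ideal.span {g}) :
    g.coeff 0 ≠ 0 := by
  intro h0
  obtain ⟨q, hdeg, hq⟩ := exists_eq_X_mul hφ h0
  have hq_mem : q ∈ Module.annihilator (SkewPolynomial D) (PetitAlgebra f hf) := by
    refine Module.mem_annihilator.mpr fun v => eq_zero_of_X_smul_eq_zero hm hirr ?_
    have hg_mem := hann.symm ▸ Ideal.mem_span_singleton_self g
    rw [← mul_smul, ← hq, Module.mem_annihilator.mp hg_mem]
  have hq0 : q = 0 :=
    eq_zero_of_deg_lt hg (hann ▸ hq_mem) ((deg_eq_natDeg hg.ne_zero).symm ▸ hdeg)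
  exact hg.ne_zero (by rw [hq, hq0, mul_zero])

end PetitAlgebra

/-- The map sending a central element `c` of `D[t;σ]` to its class `c + Rf` in the right nucleus. -/
def centerToNucleus (f : SkewPolynomial D) (hf : IsMonic f) :
    Subring.center (SkewPolynomial D) →+* NucR f hf where
  toFun c := ⟨PetitAlgebra.mk f hf c, fun x y => by
    rw [PetitAlgebra.mul_mk_center, PetitAlgebra.mul_mk_center, PetitAlgebra.mul_eq_smul,
      PetitAlgebra.mul_eq_smul, ← mul_smul, ← mul_smul, Subring.mem_center_iff.mp c.2]⟩
  map_one' := rfl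
  map_mul' c c' := Subtype.ext <| by
    change PetitAlgebra.mk f hf (c * c' : SkewPolynomial D) =
      PetitAlgebra.mk f hf c * PetitAlgebra.mk f hf c'
    rw [PetitAlgebra.mul_mk_center, ← map_smul, smul_eq_mul, Subring.mem_center_iff.mp c'.2]
  map_zero' := Subtype.ext (map_zero _)
  map_add' _ _ := Subtype.ext (map_add (PetitAlgebra.mk f hf) _ _)

variable {f : SkewPolynomial D} {hf : IsMonic f}

lemma op_centerToNucleus_smul (c : Subring.center (SkewPolynomial D)) (v : PetitAlgebra f hf) :
    MulOpposite.op (centerToNucleus f hf c) • v = (c : SkewPolynomial D) • v :=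
  PetitAlgebra.mul_mk_center c v

lemma centerToNucleus_eq_zero_iff_rightDvd (c : Subring.center (SkewPolynomial D)) :
    centerToNucleus f hf c = 0 ↔ RightDvd f (c : SkewPolynomial D) := by
  rw [rightDvd_iff_mem_span, ← PetitAlgebra.mk_eq_zero f hf]
  exact ZeroMemClass.coe_eq_zero.symm

lemma centerToNucleus_eq_zero_iff_mem_annihilator (c : Subring.center (SkewPolynomial D)) :
    centerToNucleus f hf c = 0 ↔
      (c : SkewPolynomial D) ∈ Module.annihilator (SkewPolynomial D) (PetitAlgebra f hf) := by
  rw [Module.mem_annihilator]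
  constructor
  · intro hc v
    rw [← op_centerToNucleus_smul, hc, MulOpposite.op_zero, zero_smul]
  · intro hc
    rw [centerToNucleus_eq_zero_iff_rightDvd, rightDvd_iff_mem_span, ← PetitAlgebra.mk_eq_zero f hf,
      ← PetitAlgebra.smul_one_eq_mk, hc]

end Petit

section MinimalCentralLeftMultiple

variable {D : Type*} [DivisionRing D] [MulSemiringAction (Multiplicative ℕ) D] {σ : D ≃+* D}
  {n : ℕ} {u : D} {f : SkewPolynomial D} {hf : IsMonic f}
  {h : Subring.center (SkewPolynomial D)} {hhat : Polynomial (fixedCenter σ)}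

lemma IsMclm.ne_zero (hσ : IsInnerPower σ n u) (hh : IsMclm σ n u f h hhat) :
    (h : SkewPolynomial D) ≠ 0 :=
  hh.eq_eval ▸ hσ.evalCentral_ne_zero hh.monic.ne_zero

lemma IsMclm.centerToNucleus_eq_zero (hσ : IsInnerPower σ n u) (hh : IsMclm σ n u f h hhat) :
    centerToNucleus f hf (hσ.evalCentralHom hhat) = 0 := by
  rw [centerToNucleus_eq_zero_iff_rightDvd, hσ.coe_evalCentralHom, ← hh.eq_eval]
  exact hh.rightDvd

lemma IsMclm.natDegree_le (hσ : IsInnerPower σ n u) (hh : IsMclm σ n u f h hhat)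
    {p : Polynomial (fixedCenter σ)} (hp : p ≠ 0)
    (hpf : centerToNucleus f hf (hσ.evalCentralHom p) = 0) : hhat.natDegree ≤ p.natDegree := by
  set q := p * Polynomial.C p.leadingCoeff⁻¹ with hq
  have hqmonic : q.Monic := Polynomial.monic_mul_leadingCoeff_inv hp
  have hqf : centerToNucleus f hf (hσ.evalCentralHom q) = 0 := by
    rw [hq, map_mul, map_mul, hpf, zero_mul]
  have hle := hh.minimal _ q hqmonic rfl ((centerToNucleus_eq_zero_iff_rightDvd _).mp hqf)
  rw [hh.eq_eval, hσ.coe_evalCentralHom,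
    deg_eq_natDeg (hσ.evalCentral_ne_zero hh.monic.ne_zero),
    deg_eq_natDeg (hσ.evalCentral_ne_zero hqmonic.ne_zero), Nat.cast_le,
    hσ.natDeg_evalCentral, hσ.natDeg_evalCentral,
    Polynomial.natDegree_mul_leadingCoeff_inv _ hp] at hle
  exact Nat.le_of_mul_le_mul_left hle hσ.pos

lemma IsMclm.centerToNucleus_eq_zero_iff_dvd (hσ : IsInnerPower σ n u)
    (hh : IsMclm σ n u f h hhat) (p : Polynomial (fixedCenter σ)) :
    centerToNucleus f hf (hσ.evalCentralHom p) = 0 ↔ hhat ∣ p := by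
  have hhat0 := hh.centerToNucleus_eq_zero (hf := hf) hσ
  constructor
  · intro hp
    rw [← Polynomial.modByMonic_add_div p hhat, map_add, map_add, map_mul, map_mul, hhat0, zero_mul,
      add_zero] at hp
    rw [← Polynomial.modByMonic_eq_zero_iff_dvd hh.monic]
    by_contra hne
    exact (Polynomial.natDegree_lt_natDegree hne
      (Polynomial.degree_modByMonic_lt p hh.monic)).not_ge (hh.natDegree_le hσ hne hp)
  · rintro ⟨q, rfl⟩
    rw [map_mul, map_mul, hhat0, zero_mul]

lemma IsMclm.annihilator_eq_span (hσ : IsInnerOrder σ n u) (hm : 1 < natDeg f)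
    (hirr : Irreducible f) (hh : IsMclm σ n u f h hhat) :
    Module.annihilator (SkewPolynomial D) (PetitAlgebra f hf) =
      Ideal.span {(h : SkewPolynomial D)} := by
  have hh_mem := (centerToNucleus_eq_zero_iff_mem_annihilator (hf := hf) h).mp
    ((centerToNucleus_eq_zero_iff_rightDvd h).mpr hh.rightDvd)
  refine le_antisymm ?_ ((Ideal.span_singleton_le_iff_mem _).mpr hh_mem)
  obtain ⟨g, hg, hann⟩ := exists_isMonic_eq_span_singleton
    ((Submodule.ne_bot_iff _).mpr ⟨_, hh_mem, hh.ne_zero hσ.toIsInnerPower⟩)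
  have hφ : Function.Surjective (φ : D → D) := fun z =>
    ⟨σ.symm z, (hσ.ofAdd_one_smul _).trans (σ.apply_symm_apply z)⟩
  have hg0 := PetitAlgebra.coeff_zero_ne_zero_of_annihilator_eq_span hφ hm hirr hg hann
  have : (Ideal.span {g}).IsTwoSided := hann ▸ inferInstance
  obtain ⟨p, hp⟩ := hσ.evalCentralHom_surjective ⟨_, C_inv_mul_mem_center_of_isTwoSided hg hg0⟩
  have hpg : evalCentral σ n u p = C (g.coeff 0)⁻¹ * g := congrArg Subtype.val hp
  have hspan : Ideal.span {evalCentral σ n u p} = Ideal.span {g} := by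
    rw [hpg, span_singleton_C_mul (inv_ne_zero hg0)]
  obtain ⟨q, rfl⟩ := (hh.centerToNucleus_eq_zero_iff_dvd (hf := hf) hσ.toIsInnerPower p).mp <|
    (centerToNucleus_eq_zero_iff_mem_annihilator _).mpr
      (hann ▸ hspan ▸ Ideal.mem_span_singleton_self _)
  rw [hann, ← hspan, Ideal.span_singleton_le_iff_mem, hh.eq_eval, mul_comm]
  exact Ideal.mem_span_singleton'.mpr
    ⟨_, congrArg Subtype.val (map_mul hσ.evalCentralHom q hhat).symm⟩

end MinimalCentralLeftMultiple

section RightMatrices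

variable {B V : Type*} [Ring B] [AddCommGroup V] [Module Bᵐᵒᵖ V]

/-- The coordinates of a vector with respect to a basis of a right `B`-module, as a column over `B`.
Right `B`-modules are encoded as modules over `Bᵐᵒᵖ`. -/
def rightCoord {ι : Type*} [Fintype ι] (e : Module.Basis ι Bᵐᵒᵖ V) : V ≃ₗ[Bᵐᵒᵖ] (ι → B) :=
  e.equivFun ≪≫ₗ LinearEquiv.piCongrRight fun _ => (MulOpposite.opLinearEquiv Bᵐᵒᵖ).symm

lemma rightCoord_self {ι : Type*} [Fintype ι] [DecidableEq ι] (e : Module.Basis ι Bᵐᵒᵖ V) (j : ι) :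
    rightCoord e (e j) = Pi.single j 1 := by
  ext i
  change (e.equivFun (e j) i).unop = _
  rw [Module.Basis.equivFun_self, Pi.single_apply]
  split_ifs <;> simp_all

/-- The matrix of an endomorphism of a right `B`-module with respect to a basis. -/
def endEquivMatrix {ι : Type*} [Fintype ι] [DecidableEq ι] (e : Module.Basis ι Bᵐᵒᵖ V) :
    Module.End Bᵐᵒᵖ V ≃+* Matrix ι ι B :=
  (rightCoord e).conjRingEquiv.trans <| (endVecRingEquivMatrixEnd ι Bᵐᵒᵖ B).trans
    (RingEquiv.moduleEndSelfOp B).symm.mapMatrix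

lemma endEquivMatrix_apply {ι : Type*} [Fintype ι] [DecidableEq ι] (e : Module.Basis ι Bᵐᵒᵖ V)
    (T : Module.End Bᵐᵒᵖ V) (i j : ι) : endEquivMatrix e T i j = rightCoord e (T (e j)) i := by
  have hsymm : (rightCoord e).symm (Pi.single j 1) = e j := by
    rw [LinearEquiv.symm_apply_eq, rightCoord_self]
  rw [← hsymm]
  rfl

variable {k : ℕ}

lemma colRank_endEquivMatrix (e : Module.Basis (Fin k) Bᵐᵒᵖ V) (T : Module.End Bᵐᵒᵖ V) :
    colRank (endEquivMatrix e T) = Module.finrank Bᵐᵒᵖ (LinearMap.range T) := by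
  have hcol : (endEquivMatrix e T).col = rightCoord e ∘ T ∘ e :=
    funext fun j => funext fun i => endEquivMatrix_apply e T i j
  have hspan : Submodule.span Bᵐᵒᵖ (Set.range (endEquivMatrix e T).col) =
      (LinearMap.range T).map (rightCoord e).toLinearMap := by
    rw [LinearMap.range_eq_map, ← e.span_eq, Submodule.map_span, Submodule.map_span,
      ← Set.range_comp, ← Set.range_comp, hcol]
    rfl
  rw [colRank, hspan]
  exact ((rightCoord e).submoduleMap (LinearMap.range T)).finrank_eq.symm

lemma mem_span_range_col_iff {ι κ : Type*} [Fintype κ] {M : Matrix ι κ B} {x : ι → B} :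
    x ∈ Submodule.span Bᵐᵒᵖ (Set.range M.col) ↔ ∃ y : κ → B, M.mulVec y = x := by
  simp only [Submodule.mem_span_range_iff_exists_fun, Matrix.mulVec_eq_sum]
  exact ⟨fun ⟨c, hc⟩ => ⟨fun j => (c j).unop, hc⟩, fun ⟨y, hy⟩ => ⟨fun j => .op (y j), hy⟩⟩

/-- The image of `X ↦ M X` consists of the matrices with columns in the column space of `M`. -/
def rangeMulLeftMapEquiv (M : Matrix (Fin k) (Fin k) B) :
    (Fin k → Submodule.span Bᵐᵒᵖ (Set.range M.col)) ≃ₗ[Bᵐᵒᵖ] LinearMap.range (mulLeftMap M) where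
  toFun x := ⟨Matrix.of fun i j => (x j : Fin k → B) i, by
    choose y hy using fun j => mem_span_range_col_iff.mp (x j).2
    refine ⟨Matrix.of fun i j => y j i, ?_⟩
    ext i j
    exact congrFun (hy j) i⟩
  invFun Y j := ⟨fun i => (Y : Matrix (Fin k) (Fin k) B) i j, by
    obtain ⟨_, X, rfl⟩ := Y
    exact mem_span_range_col_iff.mpr ⟨fun i => X i j, rfl⟩⟩
  left_inv _ := rfl
  right_inv _ := rfl
  map_add' _ _ := rfl
  map_smul' _ _ := rfl

lemma finrank_range_mulLeftMap [StrongRankCondition Bᵐᵒᵖ] (M : Matrix (Fin k) (Fin k) B)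
    [Module.Free Bᵐᵒᵖ (Submodule.span Bᵐᵒᵖ (Set.range M.col))] :
    Module.finrank Bᵐᵒᵖ (LinearMap.range (mulLeftMap M)) = k * colRank M := by
  have : Module.Finite Bᵐᵒᵖ (Submodule.span Bᵐᵒᵖ (Set.range M.col)) :=
    Module.Finite.span_of_finite _ (Set.finite_range _)
  rw [← (rangeMulLeftMapEquiv M).finrank_eq, Module.finrank_pi_fintype, Finset.sum_const,
    Finset.card_univ, Fintype.card_fin, smul_eq_mul, colRank]

lemma rank_map_eq_colRank {A : Type*} [CommRing A] (ε : B ≃+* A) (M : Matrix (Fin k) (Fin k) B) :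
    (M.map ε).rank = colRank M := by
  let ε' : Bᵐᵒᵖ ≃+* A := ε.op.trans (RingEquiv.toOpposite A).symm
  have := RingHomInvPair.of_ringEquiv ε'
  have := RingHomInvPair.of_ringEquiv ε'.symm
  let E : (Fin k → B) ≃ₛₗ[(ε' : Bᵐᵒᵖ →+* A)] (Fin k → A) :=
    { AddEquiv.piCongrRight fun _ : Fin k => (ε : B ≃+ A) with
      map_smul' c x := funext fun i => (map_mul ε (x i) c.unop).trans (mul_comm _ _) }
  have hspan : (Submodule.span Bᵐᵒᵖ (Set.range M.col)).map E.toLinearMap =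
      Submodule.span A (Set.range (M.map ε).col) := by
    rw [Submodule.map_span, ← Set.range_comp]
    rfl
  have hrank := lift_rank_eq_of_equiv_equiv ε' (E.submoduleMap _).toAddEquiv ε'.bijective
    fun c x =>
    (E.submoduleMap (Submodule.span Bᵐᵒᵖ (Set.range M.col))).map_smulₛₗ c x
  rw [Matrix.rank_eq_finrank_span_cols, colRank, ← hspan, Module.finrank, Module.finrank,
    ← Cardinal.toNat_lift, ← hrank, Cardinal.toNat_lift]

end RightMatrices

section FixedField

variable {D : Type*} [DivisionRing D] (σ : D ≃+* D)

lemma fixedPoints_zpowers_centerCongr :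
    FixedPoints.subfield (Subgroup.zpowers (Subring.centerCongr σ : RingAut (Subring.center D)))
      (Subring.center D) = fixedCenter σ := by
  ext c
  constructor
  · intro hc
    exact congrArg Subtype.val (hc ⟨_, Subgroup.mem_zpowers _⟩)
  · intro hc g
    have hmem : (Subring.centerCongr σ : RingAut (Subring.center D)) ∈
        MulAction.stabilizer (RingAut (Subring.center D)) c := Subtype.ext hc
    exact Subgroup.zpowers_le.mpr hmem g.2

variable {σ} {n : ℕ}

lemma centerCongr_pow_eq_one (hσn : ∀ c : Subring.center D, σ^[n] c = (c : D)) :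
    (Subring.centerCongr σ : RingAut (Subring.center D)) ^ n = 1 := by
  have hpow (j : ℕ) (c : Subring.center D) :
      (((Subring.centerCongr σ : RingAut (Subring.center D)) ^ j) c : D) = σ^[j] c := by
    induction j with
    | zero => rfl
    | succ j ih =>
      rw [pow_succ', Function.iterate_succ_apply', ← ih]
      rfl
  ext c
  rw [hpow, hσn]
  rfl

lemma finite_fixedCenter_center (hn : 0 < n) (hσn : ∀ c : Subring.center D, σ^[n] c = (c : D)) :
    Module.Finite (fixedCenter σ) (Subring.center D) := by
  have : Finite (Subgroup.zpowers (Subring.centerCongr σ : RingAut (Subring.center D))) :=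
    finite_zpowers.mpr (isOfFinOrder_iff_pow_eq_one.mpr ⟨n, hn, centerCongr_pow_eq_one hσn⟩)
  rw [← fixedPoints_zpowers_centerCongr]
  infer_instance

lemma finrank_fixedCenter_center_le (hn : 0 < n)
    (hσn : ∀ c : Subring.center D, σ^[n] c = (c : D)) :
    Module.finrank (fixedCenter σ) (Subring.center D) ≤ n := by
  have hτ := centerCongr_pow_eq_one hσn
  have : Finite (Subgroup.zpowers (Subring.centerCongr σ : RingAut (Subring.center D))) :=
    finite_zpowers.mpr (isOfFinOrder_iff_pow_eq_one.mpr ⟨n, hn, hτ⟩)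
  have := Fintype.ofFinite (Subgroup.zpowers (Subring.centerCongr σ : RingAut (Subring.center D)))
  rw [← fixedPoints_zpowers_centerCongr]
  refine (FixedPoints.finrank_le_card _ _).trans ?_
  rw [← Nat.card_eq_fintype_card, Nat.card_zpowers]
  exact orderOf_le_of_pow_eq_one hn hτ

end FixedField

section Surjective

lemma surjective_of_finrank_mul_le {F D K V A : Type*} [Field F] [DivisionRing D] [Module F D]
    [Module.Finite F D] [AddCommGroup V] [Nontrivial V] [Module D V] [Module.Finite D V]
    [Module F V] [IsScalarTower F D V] [DivisionRing K] [Module K V] [Ring A] [Algebra F A]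
    [Module.Finite F A] {T : A →+* K} (hT : Function.Injective T)
    (hTsmul : ∀ (c : F) (v : V), T (algebraMap F A c) • v = c • v)
    (hdim : Module.finrank F D * Module.finrank D V ≤ Module.finrank F A * Module.finrank K V) :
    Function.Surjective T := by
  let _ : Module F K := Module.compHom K (T.comp (algebraMap F A))
  have : IsScalarTower F K V := ⟨fun c z v => (mul_smul _ z v).trans (hTsmul c _)⟩
  have : Module.Finite F V := Module.Finite.trans D V
  have : Module.Finite K V := Module.Finite.of_restrictScalars_finite F K V
  obtain ⟨v, hv⟩ := exists_ne (0 : V)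
  have : Module.Finite F K := Module.Finite.of_injective
    ((LinearMap.toSpanSingleton K V v).restrictScalars F) (smul_left_injective K hv)
  rw [Module.finrank_mul_finrank, ← Module.finrank_mul_finrank F K V] at hdim
  let T' : A →ₗ[F] K :=
    { T with
      map_smul' c x := (congrArg T (Algebra.smul_def c x)).trans (map_mul T _ x) }
  have hle := Nat.le_of_mul_le_mul_right hdim Module.finrank_pos
  exact (LinearMap.injective_iff_surjective_of_finrank_eq_finrank (f := T')
    ((LinearMap.finrank_le_finrank_of_injective (f := T') hT).antisymm hle)).mp hT

end Surjective

section NucleusEquiv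

variable {D : Type*} [DivisionRing D] [MulSemiringAction (Multiplicative ℕ) D] {σ : D ≃+* D}
  {n : ℕ} {u : D} {f : SkewPolynomial D} {hf : IsMonic f}

lemma PetitAlgebra.isUnit_or_eq_zero (hm : 1 < natDeg f) (hirr : Irreducible f)
    (z : (NucR f hf)ᵐᵒᵖ) : IsUnit z ∨ z = 0 := by
  have := smulCommClass (hf := hf) hm
  have := isSimpleModule (hf := hf) hirr
  exact isUnit_or_eq_zero_of_forall_end_eq_smul (V := PetitAlgebra f hf) exists_nucleus_smul_eq z

lemma PetitAlgebra.nontrivial (hirr : Irreducible f) : Nontrivial (PetitAlgebra f hf) :=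
  ⟨1, 0, one_ne_zero hirr.not_isUnit⟩

lemma PetitAlgebra.nontrivial_nucleus (hirr : Irreducible f) : Nontrivial (NucR f hf) :=
  ⟨1, 0, fun h => one_ne_zero (hf := hf) hirr.not_isUnit (congrArg Subtype.val h)⟩

/-- The division ring structure on the opposite of the right nucleus of an irreducible `f`. -/
abbrev nucleusOpDivisionRing (hf : IsMonic f) (hm : 1 < natDeg f) (hirr : Irreducible f) :
    DivisionRing (NucR f hf)ᵐᵒᵖ :=
  have := PetitAlgebra.nontrivial_nucleus (hf := hf) hirr
  .ofIsUnitOrEqZero (PetitAlgebra.isUnit_or_eq_zero hm hirr)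

lemma IsInnerPower.op_centerToNucleus_C_smul (hσ : IsInnerPower σ n u) (c : fixedCenter σ)
    (v : PetitAlgebra f hf) :
    MulOpposite.op (centerToNucleus f hf (hσ.evalCentralHom (Polynomial.C c))) • v = c • v := by
  rw [op_centerToNucleus_smul, hσ.coe_evalCentralHom, evalCentral, Polynomial.eval₂_C]
  exact PetitAlgebra.C_smul _ v

variable {h : Subring.center (SkewPolynomial D)} {hhat : Polynomial (fixedCenter σ)}

/-- The homomorphism `F[x]/(ĥ) → Nuc_r(S_f)` induced by `p ↦ p(u⁻¹tⁿ) + Rf`. -/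
def IsMclm.adjoinRootToNucleus (hh : IsMclm σ n u f h hhat) (hσ : IsInnerPower σ n u)
    (hf : IsMonic f) : AdjoinRoot hhat →+* NucR f hf :=
  Ideal.Quotient.lift (Ideal.span {hhat}) ((centerToNucleus f hf).comp hσ.evalCentralHom)
    fun _ hp => (hh.centerToNucleus_eq_zero_iff_dvd hσ _).mpr (Ideal.mem_span_singleton.mp hp)

lemma IsMclm.adjoinRootToNucleus_injective (hh : IsMclm σ n u f h hhat)
    (hσ : IsInnerPower σ n u) : Function.Injective (hh.adjoinRootToNucleus hσ hf) := by
  rw [injective_iff_map_eq_zero]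
  intro x hx
  obtain ⟨p, rfl⟩ := AdjoinRoot.mk_surjective x
  exact AdjoinRoot.mk_eq_zero.mpr ((hh.centerToNucleus_eq_zero_iff_dvd hσ p).mp hx)

lemma IsMclm.adjoinRootToNucleus_surjective (hh : IsMclm σ n u f h hhat)
    (hσ : IsInnerPower σ n u) (hm : 1 < natDeg f) (hirr : Irreducible f)
    [Module.Finite (fixedCenter σ) D]
    (hdim : Module.finrank (fixedCenter σ) D * natDeg f ≤
      hhat.natDegree * Module.finrank (NucR f hf)ᵐᵒᵖ (PetitAlgebra f hf)) :
    Function.Surjective (hh.adjoinRootToNucleus hσ hf) := by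
  let _ := nucleusOpDivisionRing hf hm hirr
  have := PetitAlgebra.nontrivial (hf := hf) hirr
  have : Module.Finite (fixedCenter σ) (AdjoinRoot hhat) := hh.monic.finite_adjoinRoot
  let T : AdjoinRoot hhat →+* (NucR f hf)ᵐᵒᵖ :=
    (hh.adjoinRootToNucleus hσ hf).toOpposite fun x y => (Commute.all x y).map _
  have hT : Function.Surjective T := by
    refine surjective_of_finrank_mul_le (D := D) (V := PetitAlgebra f hf)
      (MulOpposite.op_injective.comp (hh.adjoinRootToNucleus_injective hσ))
      hσ.op_centerToNucleus_C_smul ?_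
    rwa [PetitAlgebra.finrank_eq, (AdjoinRoot.powerBasis hh.monic.ne_zero).finrank,
      AdjoinRoot.powerBasis_dim]
  exact fun b => (hT (.op b)).imp fun x hx => MulOpposite.op_injective hx

end NucleusEquiv

section LeftMultiplication

variable {D : Type*} [DivisionRing D] [MulSemiringAction (Multiplicative ℕ) D]
  {f : SkewPolynomial D} {hf : IsMonic f} {k : ℕ}

lemma leftMulMatrix_eq_endEquivMatrix
    [SMulCommClass (SkewPolynomial D) (NucR f hf)ᵐᵒᵖ (PetitAlgebra f hf)]
    (e : Module.Basis (Fin k) (NucR f hf)ᵐᵒᵖ (PetitAlgebra f hf)) (a : SkewPolynomial D) :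
    leftMulMatrix e a = endEquivMatrix e (DistribSMul.toLinearMap _ _ a) :=
  Matrix.ext fun i j => (endEquivMatrix_apply e (DistribSMul.toLinearMap _ _ a) i j).symm

lemma finrank_range_mulLeftMap_leftMulMatrix (hm : 1 < natDeg f) (hirr : Irreducible f)
    (e : Module.Basis (Fin k) (NucR f hf)ᵐᵒᵖ (PetitAlgebra f hf)) (a : SkewPolynomial D) :
    Module.finrank (NucR f hf)ᵐᵒᵖ (LinearMap.range (mulLeftMap (leftMulMatrix e a))) =
      k * colRank (leftMulMatrix e a) := by
  let _ := nucleusOpDivisionRing hf hm hirr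
  exact finrank_range_mulLeftMap _

section Annihilator

variable {h : SkewPolynomial D} (hm : 1 < natDeg f) (hirr : Irreducible f) (h0 : h ≠ 0)
  (hann : Module.annihilator (SkewPolynomial D) (PetitAlgebra f hf) = Ideal.span {h})

include hm hirr h0 hann

lemma finite_nucleus_of_annihilator_eq_span :
    Module.Finite (NucR f hf)ᵐᵒᵖ (PetitAlgebra f hf) := by
  let _ := nucleusOpDivisionRing hf hm hirr
  have := PetitAlgebra.isSimpleModule (hf := hf) hirr
  have : Module.Finite D (SkewPolynomial D ⧸ Module.annihilator (SkewPolynomial D)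
      (PetitAlgebra f hf)) := hann ▸ finite_quotient_span_singleton h0
  exact finite_of_finite_quotient_annihilator (D := D) (A := SkewPolynomial D)
    PetitAlgebra.exists_nucleus_smul_eq

lemma natDeg_eq_finrank_nucleus_mul :
    natDeg h = Module.finrank (NucR f hf)ᵐᵒᵖ (PetitAlgebra f hf) * natDeg f := by
  let _ := nucleusOpDivisionRing hf hm hirr
  have := PetitAlgebra.isSimpleModule (hf := hf) hirr
  have := PetitAlgebra.smulCommClass (hf := hf) hm
  have := finite_nucleus_of_annihilator_eq_span hm hirr h0 hann
  rw [← finrank_quotient_span_singleton h0, ← PetitAlgebra.finrank_eq (hf := hf), ← hann]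
  exact finrank_quotient_annihilator PetitAlgebra.exists_nucleus_smul_eq

lemma nonempty_basis_nucleus (hk : natDeg h = k * natDeg f) :
    Nonempty (Module.Basis (Fin k) (NucR f hf)ᵐᵒᵖ (PetitAlgebra f hf)) := by
  let _ := nucleusOpDivisionRing hf hm hirr
  have := finite_nucleus_of_annihilator_eq_span hm hirr h0 hann
  rw [natDeg_eq_finrank_nucleus_mul hm hirr h0 hann] at hk
  exact ⟨Module.finBasisOfFinrankEq _ _ (Nat.eq_of_mul_eq_mul_right (by lia) hk)⟩

lemma natDeg_eq_card_basis_mul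
    (e : Module.Basis (Fin k) (NucR f hf)ᵐᵒᵖ (PetitAlgebra f hf)) :
    natDeg h = k * natDeg f := by
  let _ := nucleusOpDivisionRing hf hm hirr
  rw [natDeg_eq_finrank_nucleus_mul hm hirr h0 hann, Module.finrank_eq_card_basis e,
    Fintype.card_fin]

lemma colRank_leftMulMatrix_mul_add
    (e : Module.Basis (Fin k) (NucR f hf)ᵐᵒᵖ (PetitAlgebra f hf)) {a g : SkewPolynomial D}
    (hg : IsGCRD g a h) :
    colRank (leftMulMatrix e a) * natDeg f + natDeg g = natDeg h := by
  let _ := nucleusOpDivisionRing hf hm hirr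
  have := PetitAlgebra.isSimpleModule (hf := hf) hirr
  have := PetitAlgebra.smulCommClass (hf := hf) hm
  have := finite_nucleus_of_annihilator_eq_span hm hirr h0 hann
  have hg0 : g ≠ 0 := by
    rintro rfl
    obtain ⟨q, hq⟩ := hg.2.1
    exact h0 (hq.trans (mul_zero q))
  have hspan : Ideal.span {a} ⊔ Ideal.span {h} = Ideal.span {g} := by
    rw [hg.span_eq, Ideal.span_insert]
  have hrank := finrank_range_smul_mul_add (D := D) (A := SkewPolynomial D)
    (V := PetitAlgebra f hf) PetitAlgebra.exists_nucleus_smul_eq a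
  rwa [hann, hspan, finrank_quotient_span_singleton hg0, PetitAlgebra.finrank_eq,
    ← natDeg_eq_finrank_nucleus_mul hm hirr h0 hann, ← colRank_endEquivMatrix e,
    ← leftMulMatrix_eq_endEquivMatrix] at hrank

lemma colRank_leftMulMatrix
    (e : Module.Basis (Fin k) (NucR f hf)ᵐᵒᵖ (PetitAlgebra f hf)) {a g : SkewPolynomial D}
    (hg : IsGCRD g a h) :
    (colRank (leftMulMatrix e a) : ℚ) = k - 1 / (natDeg f : ℚ) * natDeg g := by
  have hm0 : (natDeg f : ℚ) ≠ 0 := Nat.cast_ne_zero.mpr (by lia)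
  have hadd := colRank_leftMulMatrix_mul_add hm hirr h0 hann e hg
  rw [natDeg_eq_card_basis_mul hm hirr h0 hann e] at hadd
  have hadd' : (colRank (leftMulMatrix e a) : ℚ) * natDeg f + natDeg g = k * natDeg f := by
    exact_mod_cast hadd
  field_simp
  linarith

end Annihilator

lemma exists_quotient_equiv_matrix {h : Subring.center (SkewPolynomial D)} (hm : 1 < natDeg f)
    (hirr : Irreducible f)
    (hann : Module.annihilator (SkewPolynomial D) (PetitAlgebra f hf) =
      Ideal.span {(h : SkewPolynomial D)})
    (e : Module.Basis (Fin k) (NucR f hf)ᵐᵒᵖ (PetitAlgebra f hf)) :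
    ∃ Ψ : (SkewPolynomial D ⧸ Ideal.span {(h : SkewPolynomial D)}) ≃+*
        Matrix (Fin k) (Fin k) (NucR f hf),
      ∀ a, Ψ (Ideal.Quotient.mk _ a) = leftMulMatrix e a := by
  let _ := nucleusOpDivisionRing hf hm hirr
  have := PetitAlgebra.isSimpleModule (hf := hf) hirr
  have := PetitAlgebra.smulCommClass (hf := hf) hm
  have : Module.Finite (NucR f hf)ᵐᵒᵖ (PetitAlgebra f hf) := .of_basis e
  let Ψ := (quotientAnnihilatorEquivEnd (A := SkewPolynomial D) (V := PetitAlgebra f hf)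
    PetitAlgebra.exists_nucleus_smul_eq).trans (endEquivMatrix e)
  refine ⟨(Ideal.quotEquivOfEq hann.symm).trans Ψ, fun a => ?_⟩
  rw [leftMulMatrix_eq_endEquivMatrix]
  rfl

end LeftMultiplication

section FullDegree

variable {D : Type*} [DivisionRing D] [MulSemiringAction (Multiplicative ℕ) D] {σ : D ≃+* D}
  {n : ℕ} {u : D}

lemma IsInnerPower.iterate_center (hσ : IsInnerPower σ n u) (c : Subring.center D) :
    σ^[n] c = (c : D) := by
  rw [hσ.iterate_eq, Subring.mem_center_iff.mp c.2 u, mul_inv_cancel_right₀ hσ.ne_zero]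

lemma IsInnerPower.finite_fixedCenter (hσ : IsInnerPower σ n u)
    [Module.Finite (Subring.center D) D] : Module.Finite (fixedCenter σ) D :=
  have := finite_fixedCenter_center hσ.pos hσ.iterate_center
  .trans (Subring.center D) D

lemma IsInnerPower.finrank_fixedCenter_le (hσ : IsInnerPower σ n u) :
    Module.finrank (fixedCenter σ) D ≤ n * Module.finrank (Subring.center D) D := by
  rw [← Module.finrank_mul_finrank (fixedCenter σ) (Subring.center D) D]
  exact Nat.mul_le_mul_right _ (finrank_fixedCenter_center_le hσ.pos hσ.iterate_center)

variable {f : SkewPolynomial D} {hf : IsMonic f} {h : Subring.center (SkewPolynomial D)}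
  {hhat : Polynomial (fixedCenter σ)}

lemma IsMclm.natDeg_eq (hσ : IsInnerPower σ n u) (hh : IsMclm σ n u f h hhat) :
    natDeg (h : SkewPolynomial D) = n * hhat.natDegree := by
  rw [hh.eq_eval, hσ.natDeg_evalCentral]

lemma IsMclm.exists_adjoinRoot_equiv_nucleus (hσ : IsInnerOrder σ n u)
    (hh : IsMclm σ n u f h hhat) (hm : 1 < natDeg f) (hirr : Irreducible f)
    [Module.Finite (Subring.center D) D]
    (hdeg : Module.finrank (Subring.center D) D * (n * natDeg f) ^ 2 ≤
      natDeg (h : SkewPolynomial D) ^ 2) :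
    ∃ ε : AdjoinRoot hhat ≃+* NucR f hf, ∀ p : Polynomial (fixedCenter σ),
      (ε (AdjoinRoot.mk hhat p) : PetitAlgebra f hf) =
        PetitAlgebra.mk f hf (evalCentral σ n u p) := by
  have hσ' := hσ.toIsInnerPower
  have := hσ'.finite_fixedCenter
  have hV := natDeg_eq_finrank_nucleus_mul hm hirr (hh.ne_zero hσ')
    (hh.annihilator_eq_span (hf := hf) hσ hm hirr)
  have hdim : Module.finrank (fixedCenter σ) D * natDeg f ≤
      hhat.natDegree * Module.finrank (NucR f hf)ᵐᵒᵖ (PetitAlgebra f hf) := by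
    refine Nat.le_of_mul_le_mul_right (c := n * natDeg f) ?_ (Nat.mul_pos hσ.pos (by lia))
    calc Module.finrank (fixedCenter σ) D * natDeg f * (n * natDeg f)
      _ ≤ n * Module.finrank (Subring.center D) D * natDeg f * (n * natDeg f) := by
          gcongr
          exact hσ'.finrank_fixedCenter_le
      _ = Module.finrank (Subring.center D) D * (n * natDeg f) ^ 2 := by ring
      _ ≤ natDeg (h : SkewPolynomial D) * natDeg (h : SkewPolynomial D) := hdeg.trans_eq (sq _)
      _ = n * hhat.natDegree *
          (Module.finrank (NucR f hf)ᵐᵒᵖ (PetitAlgebra f hf) * natDeg f) :=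
          congrArg₂ _ (hh.natDeg_eq hσ') hV
      _ = _ := by ring
  exact ⟨.ofBijective (hh.adjoinRootToNucleus hσ' hf) ⟨hh.adjoinRootToNucleus_injective hσ',
    hh.adjoinRootToNucleus_surjective hσ' hm hirr hdim⟩, fun p => rfl⟩

end FullDegree

end SkewRank

end

open SkewRank in
theorem mainTheorem4_general
    {D : Type*} [DivisionRing D] [MulSemiringAction (Multiplicative ℕ) D]
    (σ : D ≃+* D) (hσ : ∀ z : D, (Multiplicative.ofAdd 1 : Multiplicative ℕ) • z = σ z)
    (n : ℕ) (hn : 0 < n) (u : D) (hu : u ≠ 0) (hσu : σ u = u)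
    (hσn : ∀ z : D, σ^[n] z = u * z * u⁻¹)
    (hmin : ∀ j : ℕ, 0 < j → j < n → ¬ ∃ v : D, v ≠ 0 ∧ ∀ z : D, σ^[j] z = v * z * v⁻¹)
    (f : SkewPolynomial D) (hf : IsMonic f) (hirr : Irreducible f)
    (m : ℕ) (hm : 1 < m) (hdegf : deg f = (m : WithBot ℕ))
    (h : Subring.center (SkewPolynomial D))
    (hhat : Polynomial (fixedCenter σ))
    (hh : IsMclm σ n u f h hhat)
    (k : ℕ) (hdegh : deg (h : SkewPolynomial D) = ((k * m : ℕ) : WithBot ℕ)) :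
    (∀ a : SkewPolynomial D, ∃ g, IsGCRD g a (h : SkewPolynomial D)) ∧
    Nonempty (Module.Basis (Fin k) (NucR f hf)ᵐᵒᵖ (PetitAlgebra f hf)) ∧
    ∀ e : Module.Basis (Fin k) (NucR f hf)ᵐᵒᵖ (PetitAlgebra f hf),
      (∃ Ψ : (SkewPolynomial D ⧸ Ideal.span {(h : SkewPolynomial D)}) ≃+*
            Matrix (Fin k) (Fin k) (NucR f hf),
          ∀ a : SkewPolynomial D,
            Ψ (Ideal.Quotient.mk (Ideal.span {(h : SkewPolynomial D)}) a) =
              leftMulMatrix e a) ∧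
      (∀ a g : SkewPolynomial D, IsGCRD g a (h : SkewPolynomial D) →
        (Module.finrank (NucR f hf)ᵐᵒᵖ
            (LinearMap.range (mulLeftMap (leftMulMatrix e a))) : ℚ) =
          (k : ℚ) ^ 2 - (k : ℚ) / m * natDeg g ∧
        (colRank (leftMulMatrix e a) : ℚ) =
          k - 1 / (m : ℚ) * natDeg g) ∧
      (∀ d : ℕ, 0 < d → Module.finrank (Subring.center D) D = d ^ 2 →
        deg (h : SkewPolynomial D) = ((d * m * n : ℕ) : WithBot ℕ) →
        k = d * n ∧
        ∃ ε : AdjoinRoot hhat ≃+* NucR f hf,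
          (∀ p : Polynomial (fixedCenter σ),
            (ε (AdjoinRoot.mk hhat p) : PetitAlgebra f hf) =
              PetitAlgebra.mk f hf (evalCentral σ n u p)) ∧
          ∀ a g : SkewPolynomial D, IsGCRD g a (h : SkewPolynomial D) →
            (((leftMulMatrix e a).map ε.symm).rank : ℚ) =
              (d : ℚ) * n - 1 / (m : ℚ) * natDeg g) := by
  obtain rfl : natDeg f = m := natDeg_eq_of_deg_eq hdegf
  have hk : natDeg (h : SkewPolynomial D) = k * natDeg f := natDeg_eq_of_deg_eq hdegh
  have hσ' : IsInnerOrder σ n u := ⟨⟨hσ, hn, hu, hσu, hσn⟩, hmin⟩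
  have h0 := hh.ne_zero hσ'.toIsInnerPower
  have hann := hh.annihilator_eq_span (hf := hf) hσ' hm hirr
  refine ⟨fun a => exists_isGCRD a h, nonempty_basis_nucleus hm hirr h0 hann hk, fun e =>
    ⟨exists_quotient_equiv_matrix hm hirr hann e, fun a g hg => ?_, fun d hd hD hdeg => ?_⟩⟩
  · have hcol := colRank_leftMulMatrix hm hirr h0 hann e hg
    refine ⟨?_, hcol⟩
    rw [finrank_range_mulLeftMap_leftMulMatrix hm hirr, Nat.cast_mul, hcol]
    ring
  · have hdmn := natDeg_eq_of_deg_eq hdeg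
    have hkdn : k = d * n := Nat.eq_of_mul_eq_mul_right (zero_lt_one.trans hm) <| by
      rw [← hk, hdmn, mul_right_comm]
    have : Module.Finite (Subring.center D) D := Module.finite_of_finrank_pos (hD ▸ pow_pos hd 2)
    obtain ⟨ε, hε⟩ := hh.exists_adjoinRoot_equiv_nucleus (hf := hf) hσ' hm hirr <| by
      rw [hD, hdmn, ← mul_pow, mul_assoc, mul_comm n]
    refine ⟨hkdn, ε, hε, fun a g hg => ?_⟩
    rw [rank_map_eq_colRank, colRank_leftMulMatrix hm hirr h0 hann e hg, hkdn, Nat.cast_mul]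

theorem mainTheorem4
    {D : Type*} [DivisionRing D] [MulSemiringAction (Multiplicative ℕ) D]
    -- `D` is a central division algebra of degree `d` over its center
    (d : ℕ) (hd : 0 < d) (hD : Module.finrank (Subring.center D) D = d ^ 2)
    -- `σ` is the automorphism of `D` that defines `R = D[t;σ] = SkewPolynomial D`
    (σ : D ≃+* D) (hσ : ∀ z : D, (Multiplicative.ofAdd 1 : Multiplicative ℕ) • z = σ z)
    -- `σ` has finite order `n` modulo inner automorphisms, `σⁿ(z) = u z u⁻¹`, `u ∈ Fix(σ)`
    (n : ℕ) (hn : 0 < n) (u : D) (hu : u ≠ 0) (hσu : σ u = u)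
    (hσn : ∀ z : D, σ^[n] z = u * z * u⁻¹)
    (hmin : ∀ j : ℕ, 0 < j → j < n → ¬ ∃ v : D, v ≠ 0 ∧ ∀ z : D, σ^[j] z = v * z * v⁻¹)
    -- `f` is monic and irreducible of degree `m > 1` with `(f,t)_r = 1`
    (f : SkewPolynomial D) (hf : SkewRank.IsMonic f) (hirr : Irreducible f)
    (m : ℕ) (hm : 1 < m) (hdegf : SkewRank.deg f = (m : WithBot ℕ))
    (hft : SkewRank.IsGCRD 1 f SkewPolynomial.X)
    -- `h = ĥ(u⁻¹tⁿ)` is the minimal central left multiple of `f`, and `deg h = km`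
    (h : Subring.center (SkewPolynomial D))
    (hhat : Polynomial (SkewRank.fixedCenter σ))
    (hh : SkewRank.IsMclm σ n u f h hhat)
    (k : ℕ) (hdegh : SkewRank.deg (h : SkewPolynomial D) = ((k * m : ℕ) : WithBot ℕ)) :
    -- greatest common right divisors with `h` exist
    (∀ a : SkewPolynomial D, ∃ g, SkewRank.IsGCRD g a (h : SkewPolynomial D)) ∧
    -- `V_f` has a right `B`-basis with `k` elements, where `B = Nuc_r(S_f)`
    Nonempty (Module.Basis (Fin k) (SkewRank.NucR f hf)ᵐᵒᵖ (SkewRank.PetitAlgebra f hf)) ∧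
    ∀ e : Module.Basis (Fin k) (SkewRank.NucR f hf)ᵐᵒᵖ (SkewRank.PetitAlgebra f hf),
      -- `a + Rh ↦ M_a` is an isomorphism `R/Rh ≅ M_k(B)`
      (∃ Ψ : (SkewPolynomial D ⧸ Ideal.span {(h : SkewPolynomial D)}) ≃+*
            Matrix (Fin k) (Fin k) (SkewRank.NucR f hf),
          ∀ a : SkewPolynomial D,
            Ψ (Ideal.Quotient.mk (Ideal.span {(h : SkewPolynomial D)}) a) =
              SkewRank.leftMulMatrix e a) ∧
      -- the dimension of the image of `X ↦ M_a X` and the column rank of `M_a`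
      (∀ a g : SkewPolynomial D, SkewRank.IsGCRD g a (h : SkewPolynomial D) →
        (Module.finrank (SkewRank.NucR f hf)ᵐᵒᵖ
            (LinearMap.range (SkewRank.mulLeftMap (SkewRank.leftMulMatrix e a))) : ℚ) =
          (k : ℚ) ^ 2 - (k : ℚ) / m * SkewRank.natDeg g ∧
        (SkewRank.colRank (SkewRank.leftMulMatrix e a) : ℚ) =
          k - 1 / (m : ℚ) * SkewRank.natDeg g) ∧
      -- if `deg h = dmn`, then `k = dn`, `B ≅ F[x]/(ĥ)`, and `M_a` has rank `dn - deg(g)/m`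
      (SkewRank.deg (h : SkewPolynomial D) = ((d * m * n : ℕ) : WithBot ℕ) →
        k = d * n ∧
        ∃ ε : AdjoinRoot hhat ≃+* SkewRank.NucR f hf,
          (∀ p : Polynomial (SkewRank.fixedCenter σ),
            (ε (AdjoinRoot.mk hhat p) : SkewRank.PetitAlgebra f hf) =
              SkewRank.PetitAlgebra.mk f hf (SkewRank.evalCentral σ n u p)) ∧
          ∀ a g : SkewPolynomial D, SkewRank.IsGCRD g a (h : SkewPolynomial D) →
            (((SkewRank.leftMulMatrix e a).map ε.symm).rank : ℚ) =
              (d : ℚ) * n - 1 / (m : ℚ) * SkewRank.natDeg g) := by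
  obtain ⟨hgcrd, hbasis, hrank⟩ := mainTheorem4_general σ hσ n hn u hu hσu hσn hmin f hf hirr m hm
    hdegf h hhat hh k hdegh
  exact ⟨hgcrd, hbasis, fun e => ⟨(hrank e).1, (hrank e).2.1, (hrank e).2.2 d hd hD⟩⟩
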